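/- Let $(X_n)_{n\ge 1}$ be a strictly stationary sequence of real random variables on a probability space which is associated: for every finite subfamily and all coordinatewise nondecreasing functions $h,g$ of it, the covariance of $h$ and $g$ is nonnegative whenever it exists. Suppose that for some $C_1>0$ we have $|X_n|<C_1$ almost surely for all $n\ge1$, and that $\sum_{j=1}^{\infty}\mathrm{Cov}(X_1,X_j)^{1/3}<\infty$. Let $F$ be the law of $X_1$. Let $\rho:\mathbb R^2\to\mathbb R$ be a measurable symmetric function such that, for every $y\in[-C_1,C_1]$, the function $x\mapsto\rho(x,y)$ is monotone on $[-C_1,C_1]$ (nondecreasing or nonincreasing; the direction may depend on $y$). Put $$\theta=\iint\rho(x,y)\,dF(x)\,dF(y),\qquad \rho_1(x)=\int\rho(x,y)\,dF(y),\qquad h^{(2)}(x,y)=\rho(x,y)-\rho_1(x)-\rho_1(y)+\theta,$$ $$U_n=\binom n2^{-1}\sum_{1\le i<j\le n}\rho(X_i,X_j).$$ Assume that all second-order partial derivatives of the function $(x,y,x',y')\mapsto h^{(2)}(x,y)\,h^{(2)}(x',y')$ exist and are bounded on $(-C_1,C_1)^4$, that $\mathrm{Var}(\rho_1(X_1))>0$,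 that the series $\sum_{j=1}^{\infty}\mathrm{Cov}(\rho_1(X_1),\rho_1(X_{1+j}))$ converges absolutely, and that $$\sigma_U^2=\mathrm{Var}(\rho_1(X_1))+2\sum_{j=1}^{\infty}\mathrm{Cov}(\rho_1(X_1),\rho_1(X_{1+j}))>0 .$$ Then, with $\sigma_U=\sqrt{\sigma_U^2}$, $$\frac{\sqrt n\,(U_n-\theta)}{2\sigma_U}\longrightarrow N(0,1)\quad\text{in distribution as } n\to\infty .$$ -/

import Mathlib

open MeasureTheory ProbabilityTheory Filter

namespace AssocU

noncomputable section

/-- A finite family of real random variables is associated if any two coordinatewise nondecreasing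
(Borel) functions of it have nonnegative covariance, whenever that covariance exists. -/
def IsAssociated {Ω ι : Type*} [MeasurableSpace Ω] [Fintype ι] (Y : ι → Ω → ℝ)
    (P : Measure Ω) : Prop :=
  ∀ h g : (ι → ℝ) → ℝ, Measurable h → Measurable g → Monotone h → Monotone g →
    Integrable (fun ω => h (fun i => Y i ω)) P →
    Integrable (fun ω => g (fun i => Y i ω)) P →
    Integrable (fun ω => h (fun i => Y i ω) * g (fun i => Y i ω)) P →
    0 ≤ cov[fun ω => h (fun i => Y i ω), fun ω => g (fun i => Y i ω); P]

/-- A sequence is associated if each of its finite subfamilies is associated. -/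
def IsAssociatedSeq {Ω : Type*} [MeasurableSpace Ω] (X : ℕ → Ω → ℝ) (P : Measure Ω) : Prop :=
  ∀ s : Finset ℕ, IsAssociated (fun i : s => X i) P

/-- Strict stationarity: every shift of the sequence has the same law on `ℕ → ℝ`. -/
def IsStationarySeq {Ω : Type*} [MeasurableSpace Ω] (X : ℕ → Ω → ℝ) (P : Measure Ω) : Prop :=
  ∀ k : ℕ, IdentDistrib (fun ω n => X n ω) (fun ω n => X (n + k) ω) P P

/-- At every point of `s`, all second-order partial derivatives of `f` (pure and mixed) exist,
and they are bounded on `s` by a common constant. -/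
def HasBoundedSecondPartialsOn {ι : Type*} [DecidableEq ι] (f : (ι → ℝ) → ℝ)
    (s : Set (ι → ℝ)) : Prop :=
  ∃ M : ℝ, ∀ v ∈ s, ∀ k l : ι,
    LineDifferentiableAt ℝ f v (Pi.single k 1) ∧
    LineDifferentiableAt ℝ (fun w => lineDeriv ℝ f w (Pi.single k 1)) v (Pi.single l 1) ∧
    |lineDeriv ℝ (fun w => lineDeriv ℝ f w (Pi.single k 1)) v (Pi.single l 1)| ≤ M

/-- The U-statistic of degree 2 with kernel `ρ` based on the first `n` observations
`X 0, …, X (n - 1)`. -/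
def uStat {Ω : Type*} (ρ : ℝ → ℝ → ℝ) (X : ℕ → Ω → ℝ) (n : ℕ) (ω : Ω) : ℝ :=
  ((n.choose 2 : ℕ) : ℝ)⁻¹ *
    ∑ j ∈ Finset.range n, ∑ i ∈ Finset.range j, ρ (X i ω) (X j ω)

/-- `θ = ∫∫ ρ(x, y) dF(x) dF(y)`; here and below `F` is the marginal law. -/
def theta (ρ : ℝ → ℝ → ℝ) (F : Measure ℝ) : ℝ :=
  ∫ p : ℝ × ℝ, ρ p.1 p.2 ∂(F.prod F)

/-- `ρ₁(x) = ∫ ρ(x, y) dF(y)`. -/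
def rho1 (ρ : ℝ → ℝ → ℝ) (F : Measure ℝ) (x : ℝ) : ℝ :=
  ∫ y, ρ x y ∂F

/-- The second-order Hoeffding kernel `h⁽²⁾(x, y) = ρ(x, y) - ρ₁(x) - ρ₁(y) + θ`. -/
def hoeffding2 (ρ : ℝ → ℝ → ℝ) (F : Measure ℝ) (x y : ℝ) : ℝ :=
  ρ x y - rho1 ρ F x - rho1 ρ F y + theta ρ F

/-- `σ_U² = Var ρ₁(X 0) + 2 ∑_{j ≥ 1} Cov(ρ₁(X 0), ρ₁(X j))`, with `F` the law of `X 0`. -/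
def sigmaUSq {Ω : Type*} [MeasurableSpace Ω] (ρ : ℝ → ℝ → ℝ) (X : ℕ → Ω → ℝ)
    (P : Measure Ω) : ℝ :=
  Var[fun ω => rho1 ρ (P.map (X 0)) (X 0 ω); P] +
    2 * ∑' j : ℕ, cov[fun ω => rho1 ρ (P.map (X 0)) (X 0 ω),
      fun ω => rho1 ρ (P.map (X 0)) (X (j + 1) ω); P]

end

end AssocU

/-! By Hoeffding's decomposition, `U_n - θ` is `2/n` times the sum of `ρ₁(X_i) - θ` plus
`2/(n(n-1))` times the sum over `i < j` of `h⁽²⁾(X_i, X_j)`. The linear part produces the Gaussian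
limit. The degenerate double sum is `O(n)` in `L¹`, so after multiplication by `√n` it is
`O(n^{-1/2})`.

Linear part. Association speaks only about monotone functions, and `ρ₁` need not be monotone. But
`ρ(·, 0)` is monotone and `h⁽²⁾(·, 0)` is Lipschitz, so `±ρ₁ + M x` is nondecreasing for some sign.
Hence `y = ρ₁ - θ` is dominated by `w = ±y + 2 M x`, in the sense that increments of `w` bound those
of `y` (`exists_dominated_extension`). Newman's inequality then compares the characteristic function
of a sum of `y(X_i)` with the product over blocks. The error is governed by the variance of the
whole sum of `w(X_i)` minus the block variances, which is small relative to `n` for long blocks,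
since the variance of the `w`-sums divided by `n` converges. The powers of the block characteristic
function converge by Taylor expansion (`tendsto_charFun_sum`).

Degenerate part. Bounded second partials of `h⁽²⁾ ⊗ h⁽²⁾` give `h⁽²⁾` Lipschitz mixed differences.
Integrating indicators against derivatives, once per variable, bounds the double sum by `M (∫
|discrepancy|)²` (`abs_sum_sum_le`), hence in mean by the integrated variance of the empirical
counts. To estimate covariances of the indicators of `s < X_j`, these are smoothed at scale `δ`.
After integration in `s` the cost is of order `cov(X₀, X_j)/δ² + δ`, and `δ = cov^{1/3}` explains
the exponent in the hypothesis. -/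

namespace AssocU

/-! ### Covariance inequalities under association. -/

section Association

variable {Ω : Type*} [MeasurableSpace Ω] {P : Measure Ω} [IsProbabilityMeasure P] {X : ℕ → Ω → ℝ}

lemma memLp_of_bound {f : Ω → ℝ} (hf : Measurable f) {B : ℝ} (hB : ∀ ω, |f ω| ≤ B)
    (p : ENNReal) : MemLp f p P :=
  MemLp.of_bound hf.aestronglyMeasurable B (ae_of_all _ hB)

lemma integrable_of_abs_le {f : Ω → ℝ} (hf : Measurable f) {B : ℝ} (hB : ∀ ω, |f ω| ≤ B) :
    Integrable f P :=
  Integrable.of_bound hf.aestronglyMeasurable B (ae_of_all _ hB)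

/-- A bounded measurable functional of finitely many coordinates of a real sequence. -/
structure IsBoundedCylinder (u : (ℕ → ℝ) → ℝ) : Prop where
  measurable : Measurable u
  bounded : ∃ B, ∀ x, |u x| ≤ B
  dependsOn : ∃ N, ∀ x x' : ℕ → ℝ, (∀ i < N, x i = x' i) → u x = u x'

namespace IsBoundedCylinder

variable {u v : (ℕ → ℝ) → ℝ}

lemma add (hu : IsBoundedCylinder u) (hv : IsBoundedCylinder v) :
    IsBoundedCylinder (fun x => u x + v x) := by
  obtain ⟨mu, ⟨B, hB⟩, N, hN⟩ := hu
  obtain ⟨mv, ⟨B', hB'⟩, N', hN'⟩ := hv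
  refine ⟨mu.add mv, ⟨B + B', fun x => (abs_add_le _ _).trans (add_le_add (hB x) (hB' x))⟩,
    max N N', fun x x' h => ?_⟩
  rw [hN x x' fun i hi => h i (lt_max_of_lt_left hi),
    hN' x x' fun i hi => h i (lt_max_of_lt_right hi)]

lemma comp {φ : ℝ → ℝ} (hu : IsBoundedCylinder u) (hφ : Measurable φ)
    (hb : ∀ B, ∃ B', ∀ r, |r| ≤ B → |φ r| ≤ B') : IsBoundedCylinder (fun x => φ (u x)) := by
  obtain ⟨mu, ⟨B, hB⟩, N, hN⟩ := hu
  obtain ⟨B', hB'⟩ := hb B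
  exact ⟨hφ.comp mu, ⟨B', fun x => hB' _ (hB x)⟩, N, fun x x' h => by rw [hN x x' h]⟩

lemma const_mul (hu : IsBoundedCylinder u) (c : ℝ) : IsBoundedCylinder (fun x => c * u x) :=
  hu.comp (φ := fun r => c * r) (by fun_prop) fun B => ⟨|c| * B, fun r hr => by
    rw [abs_mul]; gcongr⟩

lemma sub (hu : IsBoundedCylinder u) (hv : IsBoundedCylinder v) :
    IsBoundedCylinder (fun x => u x - v x) := by
  simpa [sub_eq_add_neg] using hu.add (hv.const_mul (-1))

lemma cos (hu : IsBoundedCylinder u) : IsBoundedCylinder (fun x => Real.cos (u x)) :=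
  hu.comp Real.measurable_cos fun _ => ⟨1, fun r _ => Real.abs_cos_le_one r⟩

lemma sin (hu : IsBoundedCylinder u) : IsBoundedCylinder (fun x => Real.sin (u x)) :=
  hu.comp Real.measurable_sin fun _ => ⟨1, fun r _ => Real.abs_sin_le_one r⟩

lemma eval {f : ℝ → ℝ} (hf : Measurable f) {B : ℝ} (hB : ∀ x, |f x| ≤ B) (i : ℕ) :
    IsBoundedCylinder (fun x => f (x i)) :=
  ⟨hf.comp (measurable_pi_apply i), ⟨B, fun _ => hB _⟩, i + 1, fun x x' h => by
    rw [h i (Nat.lt_succ_self i)]⟩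

lemma sum {f : ℕ → (ℕ → ℝ) → ℝ} (hf : ∀ i, IsBoundedCylinder (f i)) (n : ℕ) :
    IsBoundedCylinder (fun x => ∑ i ∈ Finset.range n, f i x) := by
  induction n with
  | zero => exact ⟨by simp, ⟨0, by simp⟩, 0, by simp⟩
  | succ n ih => simpa [Finset.sum_range_succ] using ih.add (hf n)

lemma measurable_comp (hu : IsBoundedCylinder u) (hX : ∀ n, Measurable (X n)) :
    Measurable (fun ω => u (fun n => X n ω)) :=
  hu.measurable.comp (measurable_pi_lambda _ hX)

lemma memLp (hu : IsBoundedCylinder u) (hX : ∀ n, Measurable (X n)) :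
    MemLp (fun ω => u (fun n => X n ω)) 2 P :=
  memLp_of_bound (hu.measurable_comp hX) (fun _ => hu.bounded.choose_spec _) 2

lemma integrable (hu : IsBoundedCylinder u) (hX : ∀ n, Measurable (X n)) :
    Integrable (fun ω => u (fun n => X n ω)) P :=
  (hu.memLp hX).integrable (by norm_num)

end IsBoundedCylinder

/-- Association gives nonnegative covariances for monotone functionals of the whole sequence that
depend on finitely many coordinates. -/
lemma IsAssociatedSeq.cov_nonneg (h : IsAssociatedSeq X P) (hX : ∀ n, Measurable (X n))
    {u v : (ℕ → ℝ) → ℝ} (hu : IsBoundedCylinder u) (hv : IsBoundedCylinder v)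
    (mu : Monotone u) (mv : Monotone v) :
    0 ≤ cov[fun ω => u (fun n => X n ω), fun ω => v (fun n => X n ω); P] := by
  obtain ⟨N, hN⟩ := hu.dependsOn
  obtain ⟨N', hN'⟩ := hv.dependsOn
  let s := Finset.range (max N N')
  -- Extension by zero is monotone and measurable, so `u ∘ e` and `v ∘ e` are admissible test
  -- functions for the finite family indexed by `s`.
  let e : (s → ℝ) → ℕ → ℝ := fun x i => if hi : i ∈ s then x ⟨i, hi⟩ else 0
  have he : Measurable e := measurable_pi_lambda _ fun i => by
    by_cases hi : i ∈ s
    · simpa [e, hi] using measurable_pi_apply _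
    · simp [e, hi]
  have me : Monotone e := fun x y hxy i => by
    by_cases hi : i ∈ s
    · simpa [e, hi] using hxy _
    · simp [e, hi]
  have eu : ∀ ω, u (e fun i => X i ω) = u (fun n => X n ω) := fun ω => hN _ _ fun i hi => by
    have : i ∈ s := Finset.mem_range.2 (lt_max_of_lt_left hi)
    simp [e, this]
  have ev : ∀ ω, v (e fun i => X i ω) = v (fun n => X n ω) := fun ω => hN' _ _ fun i hi => by
    have : i ∈ s := Finset.mem_range.2 (lt_max_of_lt_right hi)
    simp [e, this]
  have := h s (u ∘ e) (v ∘ e) (hu.measurable.comp he) (hv.measurable.comp he) (mu.comp me)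
    (mv.comp me)
  simp only [Function.comp_apply, eu, ev] at this
  exact this (hu.integrable hX) (hv.integrable hX) ((hu.memLp hX).integrable_mul (hv.memLp hX))

/-- Covariance domination for associated sequences: if `U ± u` and `V ± v` are monotone then
`|cov(u, v)| ≤ cov(U, V)`. -/
lemma IsAssociatedSeq.abs_cov_le (h : IsAssociatedSeq X P) (hX : ∀ n, Measurable (X n))
    {u v U V : (ℕ → ℝ) → ℝ} (hu : IsBoundedCylinder u) (hv : IsBoundedCylinder v)
    (hU : IsBoundedCylinder U) (hV : IsBoundedCylinder V)
    (h₁ : Monotone fun x => U x + u x) (h₂ : Monotone fun x => U x - u x)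
    (h₃ : Monotone fun x => V x + v x) (h₄ : Monotone fun x => V x - v x) :
    |cov[fun ω => u (fun n => X n ω), fun ω => v (fun n => X n ω); P]| ≤
      cov[fun ω => U (fun n => X n ω), fun ω => V (fun n => X n ω); P] := by
  have Lu := hu.memLp (P := P) hX
  have Lv := hv.memLp (P := P) hX
  have LU := hU.memLp (P := P) hX
  have LV := hV.memLp (P := P) hX
  -- The cross terms cancel in pairs: `a₁ + a₂` gives `cov(U, V) + cov(u, v) ≥ 0`, and `a₃ + a₄`
  -- gives `cov(U, V) - cov(u, v) ≥ 0`.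
  have a₁ := h.cov_nonneg hX (hU.add hu) (hV.add hv) h₁ h₃
  have a₂ := h.cov_nonneg hX (hU.sub hu) (hV.sub hv) h₂ h₄
  have a₃ := h.cov_nonneg hX (hU.add hu) (hV.sub hv) h₁ h₄
  have a₄ := h.cov_nonneg hX (hU.sub hu) (hV.add hv) h₂ h₃
  have expand_add : ∀ {f g k : Ω → ℝ}, MemLp f 2 P → MemLp g 2 P → MemLp k 2 P →
      cov[fun ω => f ω + g ω, k; P] = cov[f, k; P] + cov[g, k; P] := fun hf hg hk =>
    covariance_add_left hf hg hk
  have expand_sub : ∀ {f g k : Ω → ℝ}, MemLp f 2 P → MemLp g 2 P → MemLp k 2 P →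
      cov[fun ω => f ω - g ω, k; P] = cov[f, k; P] - cov[g, k; P] := fun hf hg hk =>
    covariance_sub_left hf hg hk
  have expand_add' : ∀ {f g k : Ω → ℝ}, MemLp f 2 P → MemLp g 2 P → MemLp k 2 P →
      cov[k, fun ω => f ω + g ω; P] = cov[k, f; P] + cov[k, g; P] := fun hf hg hk =>
    covariance_add_right hk hf hg
  have expand_sub' : ∀ {f g k : Ω → ℝ}, MemLp f 2 P → MemLp g 2 P → MemLp k 2 P →
      cov[k, fun ω => f ω - g ω; P] = cov[k, f; P] - cov[k, g; P] := fun hf hg hk =>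
    covariance_sub_right hk hf hg
  rw [expand_add LU Lu ((hV.add hv).memLp hX), expand_add' LV Lv LU, expand_add' LV Lv Lu] at a₁
  rw [expand_sub LU Lu ((hV.sub hv).memLp hX), expand_sub' LV Lv LU, expand_sub' LV Lv Lu] at a₂
  rw [expand_add LU Lu ((hV.sub hv).memLp hX), expand_sub' LV Lv LU, expand_sub' LV Lv Lu] at a₃
  rw [expand_sub LU Lu ((hV.add hv).memLp hX), expand_add' LV Lv LU, expand_add' LV Lv Lu] at a₄
  rw [abs_le]
  constructor <;> linarith

/-- The characteristic function of a real random variable in terms of cosines and sines. -/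
lemma charFun_map_eq {S : Ω → ℝ} (hS : Measurable S) (t : ℝ) :
    charFun (P.map S) t =
      ((∫ ω, Real.cos (t * S ω) ∂P : ℝ) : ℂ) + ((∫ ω, Real.sin (t * S ω) ∂P : ℝ) : ℂ) * Complex.I := by
  rw [charFun_apply_real, integral_map hS.aemeasurable (by fun_prop)]
  have hc : Integrable (fun ω => Real.cos (t * S ω)) P :=
    integrable_of_abs_le (by fun_prop) fun ω => Real.abs_cos_le_one _
  have hs : Integrable (fun ω => Real.sin (t * S ω)) P :=
    integrable_of_abs_le (by fun_prop) fun ω => Real.abs_sin_le_one _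
  rw [← integral_complex_ofReal, ← integral_complex_ofReal, ← integral_mul_const,
    ← integral_add hc.ofReal (hs.ofReal.mul_const _)]
  congr 1 with ω
  rw [← Complex.ofReal_mul, Complex.exp_mul_I, Complex.ofReal_cos, Complex.ofReal_sin]

/-- Newman's inequality for two functionals: the joint characteristic function on the diagonal
differs from the product by at most `4 t² cov(U, V)`. -/
lemma IsAssociatedSeq.norm_charFun_add_sub_mul_le (h : IsAssociatedSeq X P)
    (hX : ∀ n, Measurable (X n)) {u v U V : (ℕ → ℝ) → ℝ} (hu : IsBoundedCylinder u)
    (hv : IsBoundedCylinder v) (hU : IsBoundedCylinder U) (hV : IsBoundedCylinder V)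
    (hUu : ∀ x x', x ≤ x' → |u x' - u x| ≤ U x' - U x)
    (hVv : ∀ x x', x ≤ x' → |v x' - v x| ≤ V x' - V x) (t : ℝ) :
    ‖charFun (P.map fun ω => u (fun n => X n ω) + v (fun n => X n ω)) t -
        charFun (P.map fun ω => u (fun n => X n ω)) t *
          charFun (P.map fun ω => v (fun n => X n ω)) t‖ ≤
      4 * t ^ 2 * cov[fun ω => U (fun n => X n ω), fun ω => V (fun n => X n ω); P] := by
  -- Cosine and sine are 1-Lipschitz, so domination of `w` by `W` passes to domination of `φ (t *
  -- w)` by `|t| * W`.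
  have mono : ∀ {w W : (ℕ → ℝ) → ℝ} {φ : ℝ → ℝ}, (∀ r r', |φ r' - φ r| ≤ |r' - r|) →
      (∀ x x', x ≤ x' → |w x' - w x| ≤ W x' - W x) →
      Monotone (fun x => |t| * W x + φ (t * w x)) ∧ Monotone (fun x => |t| * W x - φ (t * w x)) := by
    intro w W φ hφ hw
    have key : ∀ x x', x ≤ x' → |φ (t * w x') - φ (t * w x)| ≤ |t| * W x' - |t| * W x := by
      intro x x' hx
      refine (hφ _ _).trans ?_
      rw [← mul_sub, ← mul_sub, abs_mul]
      exact mul_le_mul_of_nonneg_left (hw x x' hx) (abs_nonneg t)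
    constructor <;> intro x x' hx <;> have := abs_le.1 (key x x' hx) <;> simp only <;> linarith
  have hcos : ∀ r r', |Real.cos r' - Real.cos r| ≤ |r' - r| := fun r r' => by
    simpa [Real.dist_eq] using Real.lipschitzWith_cos.dist_le_mul r' r
  have hsin : ∀ r r', |Real.sin r' - Real.sin r| ≤ |r' - r| := fun r r' => by
    simpa [Real.dist_eq] using Real.lipschitzWith_sin.dist_le_mul r' r
  have hcu := (hu.const_mul t).cos
  have hsu := (hu.const_mul t).sin
  have hcv := (hv.const_mul t).cos
  have hsv := (hv.const_mul t).sin
  have hU' := hU.const_mul |t|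
  have hV' := hV.const_mul |t|
  have bound : ∀ {φ ψ : ℝ → ℝ}, (∀ r r', |φ r' - φ r| ≤ |r' - r|) →
      (∀ r r', |ψ r' - ψ r| ≤ |r' - r|) → IsBoundedCylinder (fun x => φ (t * u x)) →
      IsBoundedCylinder (fun x => ψ (t * v x)) →
      |cov[fun ω => φ (t * u (fun n => X n ω)), fun ω => ψ (t * v (fun n => X n ω)); P]| ≤
        t ^ 2 * cov[fun ω => U (fun n => X n ω), fun ω => V (fun n => X n ω); P] := by
    intro φ ψ hφ hψ b₁ b₂
    have := h.abs_cov_le hX b₁ b₂ hU' hV' (mono hφ hUu).1 (mono hφ hUu).2 (mono hψ hVv).1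
      (mono hψ hVv).2
    refine this.trans_eq ?_
    rw [covariance_const_mul_left, covariance_const_mul_right, ← mul_assoc, abs_mul_abs_self, sq]
  have k₁ := bound hcos hcos hcu hcv
  have k₂ := bound hsin hsin hsu hsv
  have k₃ := bound hcos hsin hcu hsv
  have k₄ := bound hsin hcos hsu hcv
  have c := covariance_eq_sub (μ := P) (hcu.memLp hX) (hcv.memLp hX)
  have c₂ := covariance_eq_sub (μ := P) (hsu.memLp hX) (hsv.memLp hX)
  have c₃ := covariance_eq_sub (μ := P) (hcu.memLp hX) (hsv.memLp hX)
  have c₄ := covariance_eq_sub (μ := P) (hsu.memLp hX) (hcv.memLp hX)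
  simp only [Pi.mul_apply] at c c₂ c₃ c₄
  have i₁ := (hcu.memLp (P := P) hX).integrable_mul (hcv.memLp hX)
  have i₂ := (hsu.memLp (P := P) hX).integrable_mul (hsv.memLp hX)
  have i₃ := (hcu.memLp (P := P) hX).integrable_mul (hsv.memLp hX)
  have i₄ := (hsu.memLp (P := P) hX).integrable_mul (hcv.memLp hX)
  rw [charFun_map_eq ((hu.add hv).measurable_comp hX),
    charFun_map_eq (hu.measurable_comp hX), charFun_map_eq (hv.measurable_comp hX)]
  simp only [mul_add, Real.cos_add, Real.sin_add]
  erw [integral_sub i₁ i₂, integral_add i₄ i₃]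
  simp only [Pi.mul_apply]
  set A := cov[fun ω => Real.cos (t * u fun n => X n ω), fun ω => Real.cos (t * v fun n => X n ω); P]
  set B := cov[fun ω => Real.sin (t * u fun n => X n ω), fun ω => Real.sin (t * v fun n => X n ω); P]
  set A' := cov[fun ω => Real.cos (t * u fun n => X n ω), fun ω => Real.sin (t * v fun n => X n ω); P]
  set B' := cov[fun ω => Real.sin (t * u fun n => X n ω), fun ω => Real.cos (t * v fun n => X n ω); P]
  -- By the addition formulas the difference is `(A - B) + (A' + B') i`: four covariances, each at
  -- most `t² cov(U, V)`.
  refine le_trans (b := ‖((A - B : ℝ) : ℂ) + ((A' + B' : ℝ) : ℂ) * Complex.I‖) (le_of_eq ?_) ?_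
  · congr 1
    rw [c, c₂, c₃, c₄]
    push_cast
    ring_nf
    rw [Complex.I_sq]
    ring
  · refine (norm_add_le _ _).trans ?_
    rw [norm_mul, Complex.norm_I, mul_one, Complex.norm_real, Complex.norm_real, Real.norm_eq_abs,
      Real.norm_eq_abs]
    have := abs_sub A B
    have := abs_add_le A' B'
    linarith

end Association

/-! ### Central limit theorem for dominated functions of a stationary associated sequence. -/

section CLT

open scoped Topology

variable {Ω : Type*} [MeasurableSpace Ω] {P : Measure Ω} {X : ℕ → Ω → ℝ}

lemma IsStationarySeq.cov_shift (h : IsStationarySeq X P) {u v : (ℕ → ℝ) → ℝ}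
    (hu : Measurable u) (hv : Measurable v) (k : ℕ) :
    cov[fun ω => u (fun n => X (n + k) ω), fun ω => v (fun n => X (n + k) ω); P] =
      cov[fun ω => u (fun n => X n ω), fun ω => v (fun n => X n ω); P] := by
  rw [← covariance_map_fun (Z := fun ω n => X (n + k) ω) hu.aestronglyMeasurable
      hv.aestronglyMeasurable (h k).aemeasurable_snd,
    ← covariance_map_fun (Z := fun ω n => X n ω) hu.aestronglyMeasurable
      hv.aestronglyMeasurable (h k).aemeasurable_fst, (h k).map_eq]

lemma IsStationarySeq.map_shift (h : IsStationarySeq X P) {u : (ℕ → ℝ) → ℝ}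
    (hu : Measurable u) (k : ℕ) :
    P.map (fun ω => u (fun n => X (n + k) ω)) = P.map (fun ω => u (fun n => X n ω)) :=
  ((h k).comp hu).map_eq.symm

lemma IsStationarySeq.map_eq (h : IsStationarySeq X P) (k : ℕ) : P.map (X k) = P.map (X 0) := by
  simpa using h.map_shift (measurable_pi_apply 0) k

lemma variance_fun_zero : Var[fun _ : Ω => (0 : ℝ); P] = 0 := variance_zero P

lemma IsStationarySeq.cov_add (h : IsStationarySeq X P) {f g : ℝ → ℝ} (hf : Measurable f)
    (hg : Measurable g) (i j : ℕ) :
    cov[fun ω => f (X i ω), fun ω => g (X (i + j) ω); P] =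
      cov[fun ω => f (X 0 ω), fun ω => g (X j ω); P] := by
  have := h.cov_shift (u := fun x => f (x 0)) (v := fun x => g (x j))
    (hf.comp (measurable_pi_apply 0)) (hg.comp (measurable_pi_apply j)) i
  simpa [add_comm] using this

variable [IsProbabilityMeasure P]

/-- By stationarity the new covariances depend only on the lag, so the increments of the variance
are partial sums of the covariance series. Cesàro averaging then yields the limit of the variance
divided by `n`. -/
lemma IsStationarySeq.variance_sum_succ (h : IsStationarySeq X P) {f : ℝ → ℝ}
    (hf : Measurable f) (hL : ∀ n, MemLp (fun ω => f (X n ω)) 2 P) (n : ℕ) :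
    Var[fun ω => ∑ i ∈ Finset.range (n + 1), f (X i ω); P] =
      Var[fun ω => ∑ i ∈ Finset.range n, f (X i ω); P] +
        (Var[fun ω => f (X 0 ω); P] +
          2 * ∑ j ∈ Finset.range n, cov[fun ω => f (X 0 ω), fun ω => f (X (j + 1) ω); P]) := by
  have hS : MemLp (fun ω => ∑ i ∈ Finset.range n, f (X i ω)) 2 P :=
    memLp_finsetSum _ fun i _ => hL i
  simp only [Finset.sum_range_succ]
  rw [variance_fun_add hS (hL n), covariance_fun_sum_left' (fun i _ => hL i) (hL n)]
  have hv : Var[fun ω => f (X n ω); P] = Var[fun ω => f (X 0 ω); P] := by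
    rw [← covariance_self (hL n).aestronglyMeasurable.aemeasurable,
      ← covariance_self (hL 0).aestronglyMeasurable.aemeasurable]
    exact h.cov_add hf hf n 0
  have hc : ∑ i ∈ Finset.range n, cov[fun ω => f (X i ω), fun ω => f (X n ω); P] =
      ∑ j ∈ Finset.range n, cov[fun ω => f (X 0 ω), fun ω => f (X (j + 1) ω); P] := by
    rw [← Finset.sum_range_reflect]
    refine Finset.sum_congr rfl fun j hj => ?_
    have hj := Finset.mem_range.1 hj
    have := h.cov_add hf hf (n - 1 - j) (j + 1)
    rwa [show n - 1 - j + (j + 1) = n by omega] at this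
  rw [hv, hc]
  ring

lemma tendsto_div_of_increments {V d : ℕ → ℝ} (h0 : V 0 = 0) (hV : ∀ n, V (n + 1) = V n + d n)
    {l : ℝ} (hd : Tendsto d atTop (𝓝 l)) : Tendsto (fun n : ℕ => V n / n) atTop (𝓝 l) := by
  have : ∀ n, V n = ∑ i ∈ Finset.range n, d i := fun n => by
    induction n with
    | zero => simpa using h0
    | succ n ih => rw [hV, ih, Finset.sum_range_succ]
  simpa [this, div_eq_inv_mul] using hd.cesaro

/-- Meant for the variances of sums of the monotone `w`: association makes their increments
nondecreasing, so a linear bound alone forces convergence, without prior summability of the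
covariances of `w`. -/
lemma exists_tendsto_div_of_increments {V d : ℕ → ℝ} (h0 : V 0 = 0)
    (hV : ∀ n, V (n + 1) = V n + d n) (hd : Monotone d) {K : ℝ} (hd0 : 0 ≤ d 0)
    (hK : ∀ n : ℕ, V n ≤ K * n) : ∃ l, Tendsto (fun n : ℕ => V n / n) atTop (𝓝 l) := by
  have hsum : ∀ n, V n = ∑ i ∈ Finset.range n, d i := fun n => by
    induction n with
    | zero => simpa using h0
    | succ n ih => rw [hV, ih, Finset.sum_range_succ]
  have hdn : ∀ n, 0 ≤ d n := fun n => hd0.trans (hd (Nat.zero_le n))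
  have hb : ∀ n, d n ≤ 2 * K := by
    -- The last `n` of the first `2n` increments are each at least `d n`, so `n * d n ≤ V (2n) ≤ 2 K
    -- n`. The case `n = 0` follows from `d 0 ≤ d 1`.
    have hpos : ∀ n : ℕ, 0 < n → d n ≤ 2 * K := fun n hn => by
      have h1 : (n : ℝ) * d n ≤ V (n + n) := by
        rw [hsum, Finset.sum_range_add]
        have : ∑ _i ∈ Finset.range n, d n ≤ ∑ i ∈ Finset.range n, d (n + i) :=
          Finset.sum_le_sum fun i _ => hd (by omega)
        have h2 : 0 ≤ ∑ i ∈ Finset.range n, d i := Finset.sum_nonneg fun i _ => hdn i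
        simp only [Finset.sum_const, Finset.card_range, nsmul_eq_mul] at this
        linarith
      have h2 := hK (n + n)
      have hn' : (0 : ℝ) < n := by exact_mod_cast hn
      push_cast at h2
      refine le_of_mul_le_mul_left ?_ hn'
      linarith
    exact fun n => (hd n.le_succ).trans (hpos _ n.succ_pos)
  exact ⟨_, tendsto_div_of_increments h0 hV
    (tendsto_atTop_ciSup hd ⟨2 * K, by rintro _ ⟨n, rfl⟩; exact hb n⟩)⟩

lemma IsStationarySeq.tendsto_variance_sum_div (h : IsStationarySeq X P)
    {f : ℝ → ℝ} (hf : Measurable f)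
    (hL : ∀ n, MemLp (fun ω => f (X n ω)) 2 P)
    (hs : Summable fun j : ℕ => cov[fun ω => f (X 0 ω), fun ω => f (X (j + 1) ω); P]) :
    Tendsto (fun n : ℕ => Var[fun ω => ∑ i ∈ Finset.range n, f (X i ω); P] / n) atTop
      (𝓝 (Var[fun ω => f (X 0 ω); P] +
        2 * ∑' j : ℕ, cov[fun ω => f (X 0 ω), fun ω => f (X (j + 1) ω); P])) := by
  refine tendsto_div_of_increments ?_ (h.variance_sum_succ hf hL) ?_
  · simpa using variance_fun_zero
  · exact (hs.hasSum.tendsto_sum_nat.const_mul 2).const_add _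

/-- Newman's inequality for blocks of equal length. -/
lemma IsAssociatedSeq.norm_charFun_sum_sub_pow_le (h : IsAssociatedSeq X P)
    (hst : IsStationarySeq X P) (hX : ∀ n, Measurable (X n)) {y w : ℝ → ℝ} (hy : Measurable y)
    (hw : Measurable w) {B : ℝ} (hyB : ∀ x, |y x| ≤ B) {B' : ℝ} (hwB : ∀ x, |w x| ≤ B')
    (hyw : ∀ x x', x ≤ x' → |y x' - y x| ≤ w x' - w x) (t : ℝ) (p k : ℕ) :
    ‖charFun (P.map fun ω => ∑ i ∈ Finset.range (k * p), y (X i ω)) t -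
        charFun (P.map fun ω => ∑ i ∈ Finset.range p, y (X i ω)) t ^ k‖ ≤
      2 * t ^ 2 * (Var[fun ω => ∑ i ∈ Finset.range (k * p), w (X i ω); P] -
        k * Var[fun ω => ∑ i ∈ Finset.range p, w (X i ω); P]) := by
  have cyl : ∀ {f : ℝ → ℝ} {B : ℝ}, Measurable f → (∀ x, |f x| ≤ B) → ∀ n m : ℕ,
      IsBoundedCylinder (fun x => ∑ i ∈ Finset.range n, f (x (i + m))) := fun hf hB n m =>
    IsBoundedCylinder.sum (fun i => IsBoundedCylinder.eval hf hB (i + m)) n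
  have dom : ∀ n m : ℕ, ∀ x x' : ℕ → ℝ, x ≤ x' →
      |∑ i ∈ Finset.range n, y (x' (i + m)) - ∑ i ∈ Finset.range n, y (x (i + m))| ≤
        ∑ i ∈ Finset.range n, w (x' (i + m)) - ∑ i ∈ Finset.range n, w (x (i + m)) := by
    intro n m x x' hx
    rw [← Finset.sum_sub_distrib, ← Finset.sum_sub_distrib]
    exact (Finset.abs_sum_le_sum_abs _ _).trans
      (Finset.sum_le_sum fun i _ => hyw _ _ (hx _))
  induction k with
  | zero =>
    simp only [zero_mul, Finset.range_zero, Finset.sum_empty, pow_zero, Nat.cast_zero, sub_zero]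
    rw [Measure.map_const]
    simp [charFun_dirac, variance_fun_zero]
  | succ k ih =>
    have key := h.norm_charFun_add_sub_mul_le hX (cyl hy hyB (k * p) 0) (cyl hy hyB p (k * p))
      (cyl hw hwB (k * p) 0) (cyl hw hwB p (k * p)) (dom _ _) (dom _ _) t
    simp only [add_zero] at key
    have hshift : P.map (fun ω => ∑ i ∈ Finset.range p, y (X (i + k * p) ω)) =
        P.map (fun ω => ∑ i ∈ Finset.range p, y (X i ω)) :=
      hst.map_shift (u := fun x => ∑ i ∈ Finset.range p, y (x i))
        (by simpa using (cyl hy hyB p 0).measurable) (k * p)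
    have hwshift : Var[fun ω => ∑ i ∈ Finset.range p, w (X (i + k * p) ω); P] =
        Var[fun ω => ∑ i ∈ Finset.range p, w (X i ω); P] := by
      have hm := (cyl hw hwB p 0).measurable
      simp only [add_zero] at hm
      rw [← covariance_self, ← covariance_self]
      · exact hst.cov_shift hm hm (k * p)
      · exact ((cyl hw hwB p 0).measurable_comp hX).aemeasurable
      · exact ((cyl hw hwB p (k * p)).measurable_comp hX).aemeasurable
    have split : ∀ f : ℝ → ℝ, (fun ω => ∑ i ∈ Finset.range ((k + 1) * p), f (X i ω)) =
        fun ω => ∑ i ∈ Finset.range (k * p), f (X i ω) +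
          ∑ i ∈ Finset.range p, f (X (i + k * p) ω) := fun f => by
      funext ω
      rw [add_mul, one_mul, Finset.sum_range_add]
      simp [add_comm]
    rw [hshift] at key
    have hadd := variance_fun_add ((cyl hw hwB (k * p) 0).memLp (P := P) hX)
      ((cyl hw hwB p (k * p)).memLp hX)
    simp only [add_zero] at hadd
    rw [split y, split w, hadd, hwshift]
    set φ := charFun (P.map fun ω => ∑ i ∈ Finset.range p, y (X i ω)) t
    set ψ := charFun (P.map fun ω => ∑ i ∈ Finset.range (k * p), y (X i ω)) t
    have hφ : ‖φ‖ ≤ 1 := by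
      have : IsProbabilityMeasure (P.map fun ω => ∑ i ∈ Finset.range p, y (X i ω)) :=
        Measure.isProbabilityMeasure_map
          ((cyl hy hyB p 0).measurable_comp hX).aemeasurable
      exact norm_charFun_le_one t
    have h2 : ‖ψ * φ - φ ^ (k + 1)‖ ≤ ‖ψ - φ ^ k‖ := by
      rw [pow_succ, ← sub_mul, norm_mul]
      exact mul_le_of_le_one_right (norm_nonneg _) hφ
    -- Twice the covariance of two sums is the variance of the total minus the two variances, so `4
    -- t² cov` becomes `2 t²` times a difference and the errors telescope over the blocks.
    refine (norm_sub_le_norm_sub_add_norm_sub _ (ψ * φ) _).trans ?_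
    refine (add_le_add key (h2.trans ih)).trans (le_of_eq ?_)
    push_cast
    ring

lemma norm_pow_sub_pow_le_mul {z w : ℂ} (hz : ‖z‖ ≤ 1) (hw : ‖w‖ ≤ 1) (k : ℕ) :
    ‖z ^ k - w ^ k‖ ≤ k * ‖z - w‖ := by
  induction k with
  | zero => simp
  | succ k ih =>
    have : z ^ (k + 1) - w ^ (k + 1) = z ^ k * (z - w) + (z ^ k - w ^ k) * w := by ring
    rw [this]
    refine (norm_add_le _ _).trans ?_
    rw [norm_mul, norm_mul, norm_pow]
    have h1 : ‖z‖ ^ k * ‖z - w‖ ≤ 1 * ‖z - w‖ :=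
      mul_le_mul_of_nonneg_right (pow_le_one₀ (norm_nonneg _) hz) (norm_nonneg _)
    have h2 : ‖z ^ k - w ^ k‖ * ‖w‖ ≤ ‖z ^ k - w ^ k‖ := mul_le_of_le_one_right (norm_nonneg _) hw
    push_cast
    linarith

/-- For centred `Z` both functions have the expansion `1 - Var[Z] s² / 2` up to `o(s²)` at the
origin. -/
lemma charFun_sub_exp_isLittleO {Z : Ω → ℝ} (hZ : MemLp Z 2 P) (h0 : P[Z] = 0) :
    (fun s : ℝ => charFun (P.map Z) s - Complex.exp (-(Var[Z; P] : ℂ) * s ^ 2 / 2)) =o[𝓝 0]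
      fun s => s ^ 2 := by
  have hm := hZ.aestronglyMeasurable.aemeasurable
  have hp : IsProbabilityMeasure (P.map Z) := Measure.isProbabilityMeasure_map hm
  have hid : MemLp id 2 (P.map Z) := by
    rw [memLp_map_measure_iff (by fun_prop) hm]
    simpa using hZ
  have hv : Var[Z; P] = P[Z ^ 2] := by
    rw [variance_eq_sub hZ, h0]; simp
  have e1 : (fun s : ℝ => charFun (P.map Z) s - (1 - (Var[Z; P] : ℂ) * s ^ 2 / 2)) =o[𝓝 0]
      fun s => s ^ 2 := by
    have := taylor_isLittleO_univ (x₀ := (0 : ℝ)) (n := 2) (f := charFun (P.map Z))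
      (contDiff_charFun hid)
    simp only [taylorWithinEval_charFun_two_zero hm hid, h0, sub_zero] at this
    rw [hv]
    simpa using this
  have e2 : (fun s : ℝ => Complex.exp (-(Var[Z; P] : ℂ) * s ^ 2 / 2) -
      (1 - (Var[Z; P] : ℂ) * s ^ 2 / 2)) =o[𝓝 0] fun s => s ^ 2 := by
    have hexp := (hasDerivAt_iff_isLittleO.1 (Complex.hasDerivAt_exp 0))
    have ht : Tendsto (fun s : ℝ => -(Var[Z; P] : ℂ) * (s : ℂ) ^ 2 / 2) (𝓝 0) (𝓝 0) := by
      have : Continuous (fun s : ℝ => -(Var[Z; P] : ℂ) * (s : ℂ) ^ 2 / 2) := by fun_prop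
      simpa using this.tendsto 0
    have := hexp.comp_tendsto ht
    refine (this.congr_left fun s => ?_).trans_isBigO ?_
    · simp
      ring
    · refine Asymptotics.IsBigO.of_bound (|Var[Z; P]| / 2) (Eventually.of_forall fun s => ?_)
      simp
      exact le_of_eq (by ring)
  simpa using e1.sub e2

lemma tendsto_natDiv_div (p : ℕ) :
    Tendsto (fun n : ℕ => ((n / p : ℕ) : ℝ) / n) atTop (𝓝 ((p : ℝ)⁻¹)) := by
  have := (tendsto_nat_floor_mul_div_atTop (R := ℝ) (a := (p : ℝ)⁻¹) (by positivity)).comp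
    tendsto_natCast_atTop_atTop
  refine this.congr fun n => ?_
  simp only [Function.comp_apply]
  rw [inv_mul_eq_div, Nat.floor_div_eq_div]

/-- The limit theorem as if the `n / p` blocks were independent. Comparing powers costs a factor at
most `n`, which the `o(1/n)` error at `t / √n` absorbs. -/
lemma tendsto_charFun_pow_natDiv {Z : Ω → ℝ} (hZ : MemLp Z 2 P) (h0 : P[Z] = 0) (t : ℝ) (p : ℕ) :
    Tendsto (fun n : ℕ => charFun (P.map Z) (t / √n) ^ (n / p)) atTop
      (𝓝 (Complex.exp (-((Var[Z; P] / p : ℝ) : ℂ) * t ^ 2 / 2))) := by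
  have hm := hZ.aestronglyMeasurable.aemeasurable
  have hp : IsProbabilityMeasure (P.map Z) := Measure.isProbabilityMeasure_map hm
  have hts : Tendsto (fun n : ℕ => t / √(n : ℝ)) atTop (𝓝 0) :=
    tendsto_const_nhds.div_atTop (Real.tendsto_sqrt_atTop.comp tendsto_natCast_atTop_atTop)
  have hlo := (charFun_sub_exp_isLittleO hZ h0).comp_tendsto hts
  have hD : Tendsto (fun n : ℕ => (n : ℝ) * ‖charFun (P.map Z) (t / √n) -
      Complex.exp (-(Var[Z; P] : ℂ) * ((t / √n : ℝ) : ℂ) ^ 2 / 2)‖) atTop (𝓝 0) := by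
    have h1 : (fun n : ℕ => (n : ℝ) * ‖charFun (P.map Z) (t / √n) -
        Complex.exp (-(Var[Z; P] : ℂ) * ((t / √n : ℝ) : ℂ) ^ 2 / 2)‖) =o[atTop]
        fun n : ℕ => (n : ℝ) * (t / √n) ^ 2 :=
      (Asymptotics.isBigO_refl _ _).mul_isLittleO hlo.norm_left
    have h2 : (fun n : ℕ => (n : ℝ) * (t / √n) ^ 2) =O[atTop] fun _ => (1 : ℝ) := by
      refine Asymptotics.IsBigO.of_bound (t ^ 2) (Eventually.of_forall fun n => ?_)
      rw [div_pow, Real.sq_sqrt (Nat.cast_nonneg n)]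
      rcases Nat.eq_zero_or_pos n with rfl | hn
      · simp; positivity
      · have : (n : ℝ) ≠ 0 := by positivity
        rw [mul_div_cancel₀ _ this]; simp
    exact (Asymptotics.isLittleO_one_iff ℝ).1 (h1.trans_isBigO h2)
  have hE : Tendsto (fun n : ℕ =>
      Complex.exp (-(Var[Z; P] : ℂ) * ((t / √n : ℝ) : ℂ) ^ 2 / 2) ^ (n / p)) atTop
      (𝓝 (Complex.exp (-((Var[Z; P] / p : ℝ) : ℂ) * t ^ 2 / 2))) := by
    have hr : Tendsto (fun n : ℕ => Complex.exp
        (((-(Var[Z; P] * t ^ 2 / 2) * (((n / p : ℕ) : ℝ) / n) : ℝ)) : ℂ)) atTop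
        (𝓝 (Complex.exp ((-(Var[Z; P] * t ^ 2 / 2) * (p : ℝ)⁻¹ : ℝ) : ℂ))) := by
      refine (Complex.continuous_exp.tendsto _).comp ((Complex.continuous_ofReal.tendsto _).comp ?_)
      exact (tendsto_natDiv_div p).const_mul _
    convert hr using 2 with n
    · rw [← Complex.exp_nat_mul]
      congr 1
      rw [← Complex.ofReal_pow, div_pow, Real.sq_sqrt (Nat.cast_nonneg n)]
      push_cast
      ring
    · push_cast
      ring_nf
  refine tendsto_of_tendsto_of_dist hE ?_
  refine squeeze_zero (fun _ => dist_nonneg) (fun n => ?_) hD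
  rw [dist_comm, dist_eq_norm]
  refine (norm_pow_sub_pow_le_mul (norm_charFun_le_one _) ?_ _).trans ?_
  · rw [Complex.norm_exp]
    have : (-(Var[Z; P] : ℂ) * ((t / √n : ℝ) : ℂ) ^ 2 / 2) =
        ((-(Var[Z; P] * (t / √n) ^ 2 / 2) : ℝ) : ℂ) := by push_cast; ring
    rw [this, Complex.ofReal_re, Real.exp_le_one_iff]
    have := variance_nonneg Z P
    have : 0 ≤ Var[Z; P] * (t / √n) ^ 2 := by positivity
    linarith
  · gcongr
    exact Nat.div_le_self n p

/-- The map `r ↦ exp(i r)` is 1-Lipschitz, so `L¹`-small perturbations are harmless. This removes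
both the incomplete last block and the degenerate part. -/
lemma norm_charFun_sub_le {S T : Ω → ℝ} (hS : Measurable S) (hT : Measurable T)
    (hST : Integrable (fun ω => S ω - T ω) P) (t : ℝ) :
    ‖charFun (P.map S) t - charFun (P.map T) t‖ ≤ |t| * ∫ ω, |S ω - T ω| ∂P := by
  rw [charFun_apply_real, charFun_apply_real, integral_map hS.aemeasurable (by fun_prop),
    integral_map hT.aemeasurable (by fun_prop)]
  have hi : ∀ {R : Ω → ℝ}, Measurable R →
      Integrable (fun ω => Complex.exp (t * R ω * Complex.I)) P := fun {R} hR => by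
    refine Integrable.of_bound (by fun_prop) 1 (ae_of_all _ fun ω => ?_)
    rw [← Complex.ofReal_mul, Complex.norm_exp_ofReal_mul_I]
  rw [← integral_sub (hi hS) (hi hT), ← integral_const_mul]
  refine (norm_integral_le_integral_norm _).trans ?_
  refine integral_mono ((hi hS).sub (hi hT)).norm (hST.abs.const_mul _) fun ω => ?_
  have : Complex.exp (t * S ω * Complex.I) - Complex.exp (t * T ω * Complex.I) =
      Complex.exp (t * T ω * Complex.I) *
        (Complex.exp (Complex.I * ((t * (S ω - T ω) : ℝ) : ℂ)) - 1) := by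
    rw [mul_sub, ← Complex.exp_add, mul_one]
    congr 2
    push_cast
    ring
  simp only
  rw [this, norm_mul, ← Complex.ofReal_mul, Complex.norm_exp_ofReal_mul_I, one_mul]
  refine (Real.norm_exp_I_mul_ofReal_sub_one_le).trans ?_
  rw [Real.norm_eq_abs, abs_mul]

/-- The central limit theorem for `y(X_j)`, where `(X_j)` is a stationary associated sequence,
`y` is dominated by a function `w` whose partial sums have variance of linear order. -/
theorem IsAssociatedSeq.tendsto_charFun_sum (h : IsAssociatedSeq X P)
    (hst : IsStationarySeq X P) (hX : ∀ n, Measurable (X n)) {y w : ℝ → ℝ} (hy : Measurable y)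
    (hw : Measurable w) {B : ℝ} (hyB : ∀ x, |y x| ≤ B) {B' : ℝ} (hwB : ∀ x, |w x| ≤ B')
    (hyw : ∀ x x', x ≤ x' → |y x' - y x| ≤ w x' - w x)
    (h0 : ∀ n, ∫ ω, y (X n ω) ∂P = 0) {σ K : ℝ}
    (hσ : Tendsto (fun n : ℕ => Var[fun ω => ∑ i ∈ Finset.range n, y (X i ω); P] / n) atTop (𝓝 σ))
    (hK : ∀ n : ℕ, Var[fun ω => ∑ i ∈ Finset.range n, w (X i ω); P] ≤ K * n) (t : ℝ) :
    Tendsto (fun n : ℕ => charFun (P.map fun ω => ∑ i ∈ Finset.range n, y (X i ω)) (t / √n)) atTop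
      (𝓝 (Complex.exp (-(σ : ℂ) * t ^ 2 / 2))) := by
  have mw : Monotone w := fun x x' hx => by
    linarith [(abs_nonneg _).trans (hyw x x' hx)]
  have hwL : ∀ n, MemLp (fun ω => w (X n ω)) 2 P := fun n =>
    memLp_of_bound (hw.comp (hX n)) (fun _ => hwB _) 2
  have hyL : ∀ n, MemLp (fun ω => y (X n ω)) 2 P := fun n =>
    memLp_of_bound (hy.comp (hX n)) (fun _ => hyB _) 2
  have hyS : ∀ n, MemLp (fun ω => ∑ i ∈ Finset.range n, y (X i ω)) 2 P := fun n =>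
    memLp_finsetSum _ fun i _ => hyL i
  have hySm : ∀ n, Measurable (fun ω => ∑ i ∈ Finset.range n, y (X i ω)) := fun n =>
    Finset.measurable_sum _ fun i _ => hy.comp (hX i)
  have hyS0 : ∀ n, ∫ ω, ∑ i ∈ Finset.range n, y (X i ω) ∂P = 0 := fun n => by
    rw [integral_finsetSum _ fun i _ => (hyL i).integrable (by norm_num)]
    simp [h0]
  set V : ℕ → ℝ := fun n => Var[fun ω => ∑ i ∈ Finset.range n, w (X i ω); P] with hV
  obtain ⟨τ, hτ⟩ : ∃ τ, Tendsto (fun n : ℕ => V n / n) atTop (𝓝 τ) := by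
    refine exists_tendsto_div_of_increments ?_ (hst.variance_sum_succ hw hwL) ?_ ?_ hK
    · simpa [hV] using variance_fun_zero
    · refine monotone_nat_of_le_succ fun n => ?_
      simp only [Finset.sum_range_succ]
      have := h.cov_nonneg hX (IsBoundedCylinder.eval hw hwB 0)
        (IsBoundedCylinder.eval hw hwB (n + 1)) (fun x x' hx => mw (hx _)) fun x x' hx => mw (hx _)
      linarith
    · simp [variance_nonneg]
  set c : ℕ → ℂ := fun p =>
    Complex.exp (-((Var[fun ω => ∑ i ∈ Finset.range p, y (X i ω); P] / p : ℝ) : ℂ) * t ^ 2 / 2)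
    with hc
  set L := Complex.exp (-(σ : ℂ) * t ^ 2 / 2) with hL
  have hcL : Tendsto c atTop (𝓝 L) := by
    have hcont : Continuous fun s : ℝ => Complex.exp (-(s : ℂ) * t ^ 2 / 2) := by fun_prop
    exact (hcont.tendsto σ).comp hσ
  have hsq : Tendsto (fun n : ℕ => (√(n : ℝ))⁻¹) atTop (𝓝 0) :=
    (Real.tendsto_sqrt_atTop.comp tendsto_natCast_atTop_atTop).inv_tendsto_atTop
  -- For a fixed block length there are three errors: fewer than `p` leftover terms, vanishing as
  -- `n` grows; Newman's inequality at `t / √n`, tending to `2 t² (τ - V p / p)`; and the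
  -- convergence of the block power to `c p`.
  have block : ∀ p : ℕ, 0 < p → ∀ δ > 0, ∀ᶠ n : ℕ in atTop,
      ‖charFun (P.map fun ω => ∑ i ∈ Finset.range n, y (X i ω)) (t / √n) - L‖ ≤
        2 * t ^ 2 * (τ - V p / p) + ‖c p - L‖ + δ := by
    intro p hp δ hδ
    have hp' : (0 : ℝ) < p := by exact_mod_cast hp
    have hA : Tendsto (fun n : ℕ => |t| * (√(n : ℝ))⁻¹ * (p * B)) atTop (𝓝 0) := by
      simpa using (hsq.const_mul |t|).mul_const (p * B)
    have hkp : Tendsto (fun n : ℕ => n / p * p) atTop atTop :=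
      (Nat.tendsto_div_const_atTop hp.ne').atTop_mul_const' hp
    have hB : Tendsto (fun n : ℕ => 2 * (t / √n) ^ 2 * (V (n / p * p) - (n / p : ℕ) * V p)) atTop
        (𝓝 (2 * t ^ 2 * (τ - V p / p))) := by
      have h1 : Tendsto (fun n : ℕ => 2 * t ^ 2 * (V (n / p * p) / ((n / p * p : ℕ) : ℝ) *
          (((n / p : ℕ) : ℝ) / n * p) - ((n / p : ℕ) : ℝ) / n * V p)) atTop
          (𝓝 (2 * t ^ 2 * (τ * ((p : ℝ)⁻¹ * p) - (p : ℝ)⁻¹ * V p))) :=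
        (((hτ.comp hkp).mul ((tendsto_natDiv_div p).mul_const _)).sub
          ((tendsto_natDiv_div p).mul_const _)).const_mul _
      rw [inv_mul_cancel₀ hp'.ne', mul_one, inv_mul_eq_div] at h1
      refine h1.congr' ?_
      filter_upwards [eventually_ge_atTop p] with n hn
      have hn0 : (0 : ℝ) < n := by exact_mod_cast hp.trans_le hn
      have hk0 : (0 : ℝ) < (n / p : ℕ) := by exact_mod_cast Nat.div_pos hn hp
      rw [div_pow, Real.sq_sqrt hn0.le]
      push_cast
      field_simp
    have hC := (tendsto_charFun_pow_natDiv (hyS p) (hyS0 p) t p)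
    have hC' := tendsto_iff_norm_sub_tendsto_zero.1 hC
    have htot := (hA.add hB).add hC'
    rw [zero_add, add_zero] at htot
    filter_upwards [htot.eventually_le_const (lt_add_of_pos_right _ hδ)] with n hn
    have e1 : ‖charFun (P.map fun ω => ∑ i ∈ Finset.range n, y (X i ω)) (t / √n) -
        charFun (P.map fun ω => ∑ i ∈ Finset.range (n / p * p), y (X i ω)) (t / √n)‖ ≤
        |t| * (√(n : ℝ))⁻¹ * (p * B) := by
      refine (norm_charFun_sub_le (hySm _) (hySm _)
        (((hyS _).sub (hyS _)).integrable (by norm_num)) _).trans ?_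
      rw [abs_div, abs_of_nonneg (Real.sqrt_nonneg _), div_eq_mul_inv]
      refine mul_le_mul_of_nonneg_left ?_ (by positivity)
      have hbd : ∀ ω, |∑ i ∈ Finset.range n, y (X i ω) -
          ∑ i ∈ Finset.range (n / p * p), y (X i ω)| ≤ p * B := fun ω => by
        have hle : n / p * p ≤ n := Nat.div_mul_le_self n p
        rw [← Finset.sum_range_add_sum_Ico _ hle, add_sub_cancel_left]
        refine (Finset.abs_sum_le_sum_abs _ _).trans ((Finset.sum_le_card_nsmul _ _ B
          fun i _ => hyB _).trans ?_)
        rw [nsmul_eq_mul, Nat.card_Ico]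
        refine mul_le_mul_of_nonneg_right ?_ ((abs_nonneg _).trans (hyB 0))
        have hmod := Nat.mod_lt n hp
        have := Nat.div_add_mod' n p
        exact_mod_cast (by omega : n - n / p * p ≤ p)
      refine (integral_mono_of_nonneg (ae_of_all _ fun _ => abs_nonneg _)
        (integrable_const (p * B)) (ae_of_all _ hbd)).trans (by simp)
    have e2 := h.norm_charFun_sum_sub_pow_le hst hX hy hw hyB hwB hyw (t / √n) p (n / p)
    have e3 := norm_sub_le_norm_sub_add_norm_sub
      (charFun (P.map fun ω => ∑ i ∈ Finset.range n, y (X i ω)) (t / √n))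
      (charFun (P.map fun ω => ∑ i ∈ Finset.range (n / p * p), y (X i ω)) (t / √n)) L
    have e4 := norm_sub_le_norm_sub_add_norm_sub
      (charFun (P.map fun ω => ∑ i ∈ Finset.range (n / p * p), y (X i ω)) (t / √n))
      (charFun (P.map fun ω => ∑ i ∈ Finset.range p, y (X i ω)) (t / √n) ^ (n / p)) L
    have e5 := norm_sub_le_norm_sub_add_norm_sub
      (charFun (P.map fun ω => ∑ i ∈ Finset.range p, y (X i ω)) (t / √n) ^ (n / p)) (c p) L
    simp only [hV, hc] at *
    linarith
  rw [Metric.tendsto_nhds]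
  intro ε hε
  -- Only now does the block length grow: `V p / p → τ` removes the dependence error, and `c p → L`
  -- identifies the limit.
  have hlim : Tendsto (fun p : ℕ => 2 * t ^ 2 * (τ - V p / p) + ‖c p - L‖) atTop (𝓝 0) := by
    have := ((hτ.const_sub τ).const_mul (2 * t ^ 2)).add (tendsto_iff_norm_sub_tendsto_zero.1 hcL)
    simpa using this
  obtain ⟨p, hp, hp0⟩ := ((hlim.eventually_lt_const (half_pos hε)).and
    (eventually_gt_atTop 0)).exists
  filter_upwards [block p hp0 (ε / 2 / 2) (by positivity)] with n hn
  rw [dist_eq_norm]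
  linarith

end CLT

/-! ### Regularity of a kernel from that of its tensor square. -/

section Regularity

open Set

lemma lineDeriv_kernel_mul_eq (D : ℝ → ℝ → ℝ) (w : Fin 4 → ℝ) :
    lineDeriv ℝ (fun v : Fin 4 → ℝ => D (v 0) (v 1) * D (v 2) (v 3)) w (Pi.single 0 1) =
      deriv (fun x => D x (w 1)) (w 0) * D (w 2) (w 3) := by
  have : (fun t : ℝ => D ((w + t • Pi.single 0 1 : Fin 4 → ℝ) 0)
      ((w + t • Pi.single 0 1 : Fin 4 → ℝ) 1) * D ((w + t • Pi.single 0 1 : Fin 4 → ℝ) 2)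
      ((w + t • Pi.single 0 1 : Fin 4 → ℝ) 3)) = fun t => D (w 0 + t) (w 1) * D (w 2) (w 3) := by
    funext t
    simp
  rw [lineDeriv, this, deriv_mul_const_field, deriv_comp_const_add (f := fun x => D x (w 1)),
    add_zero]

/-- Boundedness of the second partial derivatives of `D ⊗ D` passes to `D` itself. -/
lemma HasBoundedSecondPartialsOn.kernel {D : ℝ → ℝ → ℝ} {C : ℝ}
    (h : HasBoundedSecondPartialsOn (fun v : Fin 4 → ℝ => D (v 0) (v 1) * D (v 2) (v 3))
      {v : Fin 4 → ℝ | ∀ k, v k ∈ Ioo (-C) C}) :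
    ∃ M : ℝ, 0 ≤ M ∧ ∀ x ∈ Ioo (-C) C, ∀ y ∈ Ioo (-C) C,
      DifferentiableAt ℝ (fun x => D x y) x ∧
      DifferentiableAt ℝ (fun y => deriv (fun x => D x y) x) y ∧
      |deriv (fun y => deriv (fun x => D x y) x) y| ≤ M ∧
      DifferentiableAt ℝ (deriv (fun x => D x y)) x ∧
      |deriv (deriv (fun x => D x y)) x| ≤ M := by
  -- If `D` vanishes on the square there is nothing to bound. Otherwise fixing the last two
  -- variables at a point where `D a b ≠ 0` recovers `D` from the product, up to that nonzero
  -- constant.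
  by_cases h0 : ∀ x ∈ Ioo (-C) C, ∀ y ∈ Ioo (-C) C, D x y = 0
  · refine ⟨0, le_rfl, fun x hx y hy => ?_⟩
    have e1 : ∀ y ∈ Ioo (-C) C, ∀ x ∈ Ioo (-C) C, (fun x => D x y) =ᶠ[nhds x] fun _ => 0 :=
      fun y hy x hx => by
        filter_upwards [isOpen_Ioo.mem_nhds hx] with x' hx' using h0 x' hx' y hy
    have e2 : (fun y => deriv (fun x => D x y) x) =ᶠ[nhds y] fun _ => 0 := by
      filter_upwards [isOpen_Ioo.mem_nhds hy] with y' hy'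
      rw [(e1 y' hy' x hx).deriv_eq, deriv_const]
    have e3 : deriv (fun x => D x y) =ᶠ[nhds x] fun _ => 0 := by
      filter_upwards [isOpen_Ioo.mem_nhds hx] with x' hx'
      rw [(e1 y hy x' hx').deriv_eq, deriv_const]
    refine ⟨(e1 y hy x hx).differentiableAt_iff.2 (differentiableAt_const _),
      e2.differentiableAt_iff.2 (differentiableAt_const _), ?_,
      e3.differentiableAt_iff.2 (differentiableAt_const _), ?_⟩
    · rw [e2.deriv_eq, deriv_const, abs_zero]
    · rw [e3.deriv_eq, deriv_const, abs_zero]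
  push Not at h0
  obtain ⟨a, ha, b, hb, hab⟩ := h0
  obtain ⟨M, hM⟩ := h
  have cancel : ∀ {g : ℝ → ℝ} {z : ℝ}, DifferentiableAt ℝ (fun t => g t * D a b) z →
      DifferentiableAt ℝ g z := fun {g z} hg => by
    have := hg.mul_const (D a b)⁻¹
    simpa [mul_assoc, hab] using this
  have shift : ∀ {g : ℝ → ℝ} {z : ℝ}, DifferentiableAt ℝ (fun t => g (z + t)) 0 →
      DifferentiableAt ℝ g z := fun {g z} hg => by
    have h1 : DifferentiableAt ℝ (fun t => g (z + t)) (-z + z) := by simpa using hg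
    have h2 := h1.comp z (f := fun t => -z + t) (by fun_prop)
    simpa [Function.comp_def] using h2
  have hv : ∀ x ∈ Ioo (-C) C, ∀ y ∈ Ioo (-C) C,
      (![x, y, a, b] : Fin 4 → ℝ) ∈ {v : Fin 4 → ℝ | ∀ k, v k ∈ Ioo (-C) C} := by
    intro x hx y hy k
    fin_cases k
    · exact hx
    · exact hy
    · exact ha
    · exact hb
  have hpos : ∀ {r : ℝ}, |r * D a b| ≤ M → |r| ≤ |M| / |D a b| := fun {r} hr => by
    rw [le_div_iff₀ (abs_pos.2 hab), ← abs_mul]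
    exact hr.trans (le_abs_self M)
  refine ⟨|M| / |D a b|, by positivity, fun x hx y hy => ?_⟩
  -- Two second derivatives suffice: the mixed one for mixed differences, and the pure one in the
  -- first variable for the section at `0`.
  obtain ⟨d1, d2, d3⟩ := hM _ (hv x hx y hy) 0 1
  obtain ⟨-, d4, d5⟩ := hM _ (hv x hx y hy) 0 0
  simp only [lineDeriv_kernel_mul_eq] at d2 d3 d4 d5
  simp only [LineDifferentiableAt, lineDeriv] at d1 d2 d3 d4 d5
  have f1 : (fun t : ℝ => D ((![x, y, a, b] + t • Pi.single 0 1 : Fin 4 → ℝ) 0)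
      ((![x, y, a, b] + t • Pi.single 0 1 : Fin 4 → ℝ) 1) *
        D ((![x, y, a, b] + t • Pi.single 0 1 : Fin 4 → ℝ) 2)
      ((![x, y, a, b] + t • Pi.single 0 1 : Fin 4 → ℝ) 3)) = fun t => D (x + t) y * D a b := by
    funext t; simp
  have f2 : (fun t : ℝ => deriv (fun z => D z ((![x, y, a, b] + t • Pi.single 1 1 : Fin 4 → ℝ) 1))
      ((![x, y, a, b] + t • Pi.single 1 1 : Fin 4 → ℝ) 0) *
        D ((![x, y, a, b] + t • Pi.single 1 1 : Fin 4 → ℝ) 2)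
      ((![x, y, a, b] + t • Pi.single 1 1 : Fin 4 → ℝ) 3)) =
      fun t => deriv (fun z => D z (y + t)) x * D a b := by
    funext t; simp
  have f3 : (fun t : ℝ => deriv (fun z => D z ((![x, y, a, b] + t • Pi.single 0 1 : Fin 4 → ℝ) 1))
      ((![x, y, a, b] + t • Pi.single 0 1 : Fin 4 → ℝ) 0) *
        D ((![x, y, a, b] + t • Pi.single 0 1 : Fin 4 → ℝ) 2)
      ((![x, y, a, b] + t • Pi.single 0 1 : Fin 4 → ℝ) 3)) =
      fun t => deriv (fun z => D z y) (x + t) * D a b := by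
    funext t; simp
  rw [f1] at d1
  rw [f2] at d2 d3
  rw [f3] at d4 d5
  rw [deriv_mul_const_field, deriv_comp_const_add (f := fun y => deriv (fun z => D z y) x),
    add_zero] at d3
  rw [deriv_mul_const_field, deriv_comp_const_add (f := deriv (fun z => D z y)), add_zero] at d5
  exact ⟨shift (g := fun x => D x y) (cancel d1),
    shift (g := fun y => deriv (fun z => D z y) x) (cancel d2), hpos d3,
    shift (g := deriv (fun z => D z y)) (cancel d4), hpos d5⟩

/-- Consequences for `D` of bounded second partial derivatives of `D ⊗ D` on a square: `D` is
differentiable in its first variable, has Lipschitz mixed differences, and its section at `0` is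
Lipschitz. -/
lemma HasBoundedSecondPartialsOn.exists_lipschitz {D : ℝ → ℝ → ℝ} {C : ℝ} (hC : 0 < C)
    (h : HasBoundedSecondPartialsOn (fun v : Fin 4 → ℝ => D (v 0) (v 1) * D (v 2) (v 3))
      {v : Fin 4 → ℝ | ∀ k, v k ∈ Ioo (-C) C}) :
    ∃ M : ℝ, 0 ≤ M ∧
      (∀ x ∈ Ioo (-C) C, ∀ y ∈ Ioo (-C) C, DifferentiableAt ℝ (fun x => D x y) x) ∧
      (∀ x ∈ Ioo (-C) C, ∀ x' ∈ Ioo (-C) C, ∀ y ∈ Ioo (-C) C, ∀ y' ∈ Ioo (-C) C,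
        |(D x y - D x y') - (D x' y - D x' y')| ≤ M * |y - y'| * |x - x'|) ∧
      ∀ x ∈ Ioo (-C) C, ∀ x' ∈ Ioo (-C) C, |D x 0 - D x' 0| ≤ M * |x - x'| := by
  obtain ⟨M, hM, hD⟩ := h.kernel
  have h0 : (0 : ℝ) ∈ Ioo (-C) C := ⟨by linarith, hC⟩
  have hconv : Convex ℝ (Ioo (-C) C) := convex_Ioo _ _
  -- The derivative of the section at `0` is `M`-Lipschitz, so on the interval it is at most its
  -- absolute value at `0` plus `M C`.
  set K := |deriv (fun x => D x 0) 0| + M * C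
  have hK : 0 ≤ K := by positivity
  refine ⟨max M K, le_max_of_le_left hM, fun x hx y hy => (hD x hx y hy).1, ?_, ?_⟩
  · intro x hx x' hx' y hy y' hy'
    -- The mean value inequality is used twice: in the second variable for the first derivative,
    -- then in the first variable for the difference.
    have h1 : ∀ z ∈ Ioo (-C) C, ‖deriv (fun x => D x y - D x y') z‖ ≤ M * |y - y'| := by
      intro z hz
      rw [deriv_fun_sub (hD z hz y hy).1 (hD z hz y' hy').1]
      have := hconv.norm_image_sub_le_of_norm_deriv_le (f := fun y => deriv (fun x => D x y) z)
        (C := M) (fun w hw => (hD z hz w hw).2.1) (fun w hw => (hD z hz w hw).2.2.1) hy' hy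
      simpa using this
    have := hconv.norm_image_sub_le_of_norm_deriv_le (f := fun x => D x y - D x y')
      (fun z hz => (hD z hz y hy).1.sub (hD z hz y' hy').1) h1 hx' hx
    simp only [Real.norm_eq_abs] at this
    refine this.trans ?_
    gcongr
    exact le_max_left _ _
  · intro x hx x' hx'
    have h1 : ∀ z ∈ Ioo (-C) C, ‖deriv (fun x => D x 0) z‖ ≤ K := by
      intro z hz
      have := hconv.norm_image_sub_le_of_norm_deriv_le (f := deriv (fun x => D x 0))
        (C := M) (fun w hw => (hD w hw 0 h0).2.2.2.1) (fun w hw => (hD w hw 0 h0).2.2.2.2) h0 hz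
      simp only [Real.norm_eq_abs, sub_zero] at this
      have h2 := abs_sub_abs_le_abs_sub (deriv (fun x => D x 0) z) (deriv (fun x => D x 0) 0)
      have h3 : M * |z| ≤ M * C := by
        gcongr
        exact (abs_lt.2 hz).le
      simp only [K, Real.norm_eq_abs]
      linarith
    have := hconv.norm_image_sub_le_of_norm_deriv_le (f := fun x => D x 0)
      (fun z hz => (hD z hz 0 h0).1) h1 hx' hx
    simp only [Real.norm_eq_abs] at this
    refine this.trans ?_
    gcongr
    exact le_max_right _ _

end Regularity

/-! ### Deterministic bounds by the empirical discrepancy. -/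

section Discrepancy

open Set

/-- The indicator of `s < z`. -/
noncomputable def stepAbove (s z : ℝ) : ℝ := if s < z then 1 else 0

lemma measurable_stepAbove : Measurable fun p : ℝ × ℝ => stepAbove p.1 p.2 :=
  Measurable.ite (measurableSet_lt measurable_fst measurable_snd) measurable_const
    measurable_const

lemma measurable_stepAbove_left (z : ℝ) : Measurable fun s => stepAbove s z :=
  measurable_stepAbove.comp measurable_prodMk_right

lemma measurable_stepAbove_right (s : ℝ) : Measurable (stepAbove s) :=
  measurable_stepAbove.comp measurable_prodMk_left

/-- The discrepancy between the counts of the points `x i`, `i < n`, above `s` and their expected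
counts under `F`. -/
noncomputable def discrepancy (F : Measure ℝ) (x : ℕ → ℝ) (n : ℕ) (s : ℝ) : ℝ :=
  ∑ i ∈ Finset.range n, (stepAbove s (x i) - F.real (Ioi s))

variable {F : Measure ℝ} [IsProbabilityMeasure F] {C : ℝ}

lemma stepAbove_eq_indicator (s : ℝ) : stepAbove s = (Ioi s).indicator 1 := by
  funext z
  simp [stepAbove, indicator]

lemma integral_stepAbove (F : Measure ℝ) (s : ℝ) : ∫ z, stepAbove s z ∂F = F.real (Ioi s) := by
  rw [stepAbove_eq_indicator, integral_indicator_one measurableSet_Ioi]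

lemma measurable_measureReal_Ioi : Measurable fun s => F.real (Ioi s) := by
  have : Antitone fun s => F.real (Ioi s) := fun s t hst =>
    measureReal_mono (Ioi_subset_Ioi hst)
  exact this.measurable

lemma measurable_discrepancy (x : ℕ → ℝ) (n : ℕ) : Measurable (discrepancy F x n) := by
  unfold discrepancy
  refine Finset.measurable_sum _ fun i _ =>
    (measurable_stepAbove_left _).sub measurable_measureReal_Ioi

lemma abs_stepAbove_sub_le_one (s z : ℝ) :
    |stepAbove s z - F.real (Ioi s)| ≤ 1 := by
  have h1 : F.real (Ioi s) ≤ 1 := measureReal_le_one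
  have h2 : 0 ≤ F.real (Ioi s) := measureReal_nonneg
  by_cases hz : s < z
  · simp only [stepAbove, hz, if_true, abs_le]
    constructor <;> linarith
  · simp only [stepAbove, hz, if_false, abs_le]
    constructor <;> linarith

lemma abs_discrepancy_le (x : ℕ → ℝ) (n : ℕ) (s : ℝ) : |discrepancy F x n s| ≤ n := by
  refine (Finset.abs_sum_le_sum_abs _ _).trans ?_
  refine (Finset.sum_le_sum fun i _ => abs_stepAbove_sub_le_one s (x i)).trans ?_
  simp

lemma integrableOn_discrepancy (x : ℕ → ℝ) (n : ℕ) :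
    IntegrableOn (discrepancy F x n) (Ioo (-C) C) :=
  Measure.integrableOn_of_bounded (M := n) (by simp)
    (measurable_discrepancy x n).aestronglyMeasurable (ae_of_all _ fun s => by
      simpa using abs_discrepancy_le x n s)

/-- Fundamental theorem of calculus on an open interval, written with indicators. -/
lemma sub_eq_integral_deriv_mul_stepAbove {φ : ℝ → ℝ} {M : ℝ}
    (hφ : ∀ x ∈ Ioo (-C) C, DifferentiableAt ℝ φ x) (hM : ∀ x ∈ Ioo (-C) C, |deriv φ x| ≤ M)
    {x z : ℝ} (hx : x ∈ Ioo (-C) C) (hz : z ∈ Ioo (-C) C) :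
    φ x - φ z = ∫ s in Ioo (-C) C,
      deriv φ s * (stepAbove s x - stepAbove s z) := by
  wlog hzx : z ≤ x generalizing x z
  · rw [← neg_sub, this hz hx (le_of_not_ge hzx), ← integral_neg]
    congr 1 with s
    ring
  have hsub : Ico z x ⊆ Ioo (-C) C := fun s hs => ⟨hz.1.trans_le hs.1, hs.2.trans hx.2⟩
  have hsub' : uIcc z x ⊆ Ioo (-C) C := by
    rw [uIcc_of_le hzx]
    exact fun s hs => ⟨hz.1.trans_le hs.1, hs.2.trans_lt hx.2⟩
  -- As `stepAbove` uses a strict inequality, the difference of steps is the indicator of `z ≤ s <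
  -- x`.
  have e : ∀ s, deriv φ s * (stepAbove s x - stepAbove s z) =
      (Ico z x).indicator (deriv φ) s := fun s => by
    by_cases h1 : s < x <;> by_cases h2 : s < z
    · simp [stepAbove, indicator, h1, h2]
    · simp [stepAbove, indicator, h1, h2, not_lt.1 h2]
    · exact absurd (h2.trans_le hzx) h1
    · simp [stepAbove, indicator, h1, h2]
  simp only [e]
  rw [setIntegral_indicator measurableSet_Ico, inter_eq_right.2 hsub,
    integral_Ico_eq_integral_Ioc, ← intervalIntegral.integral_of_le hzx]
  refine (intervalIntegral.integral_deriv_eq_sub (fun s hs => hφ s (hsub' hs)) ?_).symm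
  rw [intervalIntegrable_iff]
  refine Measure.integrableOn_of_bounded (M := M) (by simp)
    (measurable_deriv φ).aestronglyMeasurable ?_
  refine (ae_restrict_iff' measurableSet_uIoc).2 (ae_of_all _ fun s hs => ?_)
  exact hM s (hsub' (uIoc_subset_uIcc hs))

/-- For a Lipschitz function the discrepancy between empirical sums and means is controlled by the
`L¹` norm of the discrepancy of the distribution functions. -/
lemma abs_sum_sub_integral_le {φ : ℝ → ℝ} {M : ℝ} (hmeas : Measurable φ)
    (hφ : ∀ x ∈ Ioo (-C) C, DifferentiableAt ℝ φ x) (hM : ∀ x ∈ Ioo (-C) C, |deriv φ x| ≤ M)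
    (hF : ∀ᵐ z ∂F, z ∈ Ioo (-C) C) {x : ℕ → ℝ} (hx : ∀ i, x i ∈ Ioo (-C) C) (n : ℕ) :
    |∑ i ∈ Finset.range n, (φ (x i) - ∫ z, φ z ∂F)| ≤
      M * ∫ s in Ioo (-C) C, |discrepancy F x n s| := by
  have hM0 : 0 ≤ M := (abs_nonneg _).trans (hM _ (hx 0))
  have bdd : ∀ {G : ℝ → ℝ} {K : ℝ}, Measurable G → (∀ s ∈ Ioo (-C) C, |G s| ≤ K) →
      IntegrableOn G (Ioo (-C) C) := fun {G K} hG hK =>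
    Measure.integrableOn_of_bounded (M := K) (by simp) hG.aestronglyMeasurable
      ((ae_restrict_iff' measurableSet_Ioo).2 (ae_of_all _ hK))
  have hφint : Integrable φ F := by
    have hlip : ∀ z ∈ Ioo (-C) C, |φ z| ≤ |φ (x 0)| + M * (2 * C) := fun z hz => by
      have := (convex_Ioo (-C) C).norm_image_sub_le_of_norm_deriv_le hφ hM (hx 0) hz
      simp only [Real.norm_eq_abs] at this
      have h2 := abs_sub_abs_le_abs_sub (φ z) (φ (x 0))
      have h3 : M * |z - x 0| ≤ M * (2 * C) := by
        gcongr
        have := hx 0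
        rw [abs_le]
        constructor <;> linarith [hz.1, hz.2, this.1, this.2]
      linarith
    exact Integrable.of_bound hmeas.aestronglyMeasurable _ (hF.mono fun z hz => hlip z hz)
  -- Averaging the integral representation over `z` and exchanging the integrals replaces the
  -- indicator of `s < z` by its mean.
  have point : ∀ y ∈ Ioo (-C) C, φ y - ∫ z, φ z ∂F =
      ∫ s in Ioo (-C) C, deriv φ s * (stepAbove s y - F.real (Ioi s)) := by
    intro y hy
    have h1 : φ y - ∫ z, φ z ∂F = ∫ z, (φ y - φ z) ∂F := by
      rw [integral_sub (integrable_const _) hφint]; simp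
    have h2 : ∫ z, (φ y - φ z) ∂F = ∫ z, (∫ s in Ioo (-C) C,
        deriv φ s * (stepAbove s y - stepAbove s z)) ∂F :=
      integral_congr_ae (hF.mono fun z hz => sub_eq_integral_deriv_mul_stepAbove hφ hM hy hz)
    rw [h1, h2, integral_integral_swap]
    · congr 1 with s
      have hi : Integrable (stepAbove s) F := by
        rw [stepAbove_eq_indicator]
        exact (integrable_const (1 : ℝ)).indicator measurableSet_Ioi
      rw [integral_const_mul, integral_sub (integrable_const _) hi, integral_stepAbove]
      simp
    · have hm : Measurable fun p : ℝ × ℝ =>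
          deriv φ p.2 * (stepAbove p.2 y - stepAbove p.2 p.1) :=
        ((measurable_deriv φ).comp measurable_snd).mul
          (((measurable_stepAbove_left y).comp measurable_snd).sub
            (measurable_stepAbove.comp measurable_swap))
      refine Integrable.of_bound hm.aestronglyMeasurable M ?_
      have : ∀ᵐ p ∂F.prod (volume.restrict (Ioo (-C) C)), p.2 ∈ Ioo (-C) C :=
        Measure.quasiMeasurePreserving_snd.ae (ae_restrict_mem measurableSet_Ioo)
      filter_upwards [this] with p hp
      simp only [Function.uncurry]
      rw [norm_mul]
      refine (mul_le_of_le_one_right (norm_nonneg _) ?_).trans (hM _ hp)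
      by_cases h1 : p.2 < y <;> by_cases h2 : p.2 < p.1 <;> simp [stepAbove, h1, h2]
  rw [Finset.sum_congr rfl fun i _ => point (x i) (hx i), ← integral_finsetSum]
  · have e : ∀ s, ∑ i ∈ Finset.range n,
        deriv φ s * (stepAbove s (x i) - F.real (Ioi s)) =
        deriv φ s * discrepancy F x n s := fun s => by rw [discrepancy, Finset.mul_sum]
    simp only [e]
    rw [← integral_const_mul, ← Real.norm_eq_abs]
    refine (norm_integral_le_integral_norm _).trans ?_
    refine setIntegral_mono_on ?_ ((integrableOn_discrepancy x n).abs.const_mul M)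
      measurableSet_Ioo fun s hs => ?_
    · refine (bdd (K := M * n) ((measurable_deriv φ).mul (measurable_discrepancy x n))
        fun s hs => ?_).norm
      simp only [Pi.mul_apply]
      rw [abs_mul]
      exact mul_le_mul (hM s hs) (abs_discrepancy_le x n s) (abs_nonneg _) hM0
    · rw [norm_mul]
      exact mul_le_mul_of_nonneg_right (hM s hs) (norm_nonneg _)
  · intro i _
    refine bdd (K := M) ((measurable_deriv φ).mul ((measurable_stepAbove_left _).sub
      measurable_measureReal_Ioi))
      fun s hs => ?_
    rw [abs_mul]
    exact (mul_le_of_le_one_right (abs_nonneg _) (abs_stepAbove_sub_le_one s _)).trans (hM s hs)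

/-- A degenerate symmetric kernel with Lipschitz mixed differences has its double sums controlled
by the square of the `L¹` norm of the discrepancy. -/
lemma abs_sum_sum_le {D : ℝ → ℝ → ℝ} {M : ℝ} (hmeas : Measurable fun p : ℝ × ℝ => D p.1 p.2)
    (hsymm : ∀ x y, D x y = D y x)
    (hdiff : ∀ x ∈ Ioo (-C) C, ∀ y ∈ Ioo (-C) C, DifferentiableAt ℝ (fun x => D x y) x)
    (hmix : ∀ x ∈ Ioo (-C) C, ∀ x' ∈ Ioo (-C) C, ∀ y ∈ Ioo (-C) C, ∀ y' ∈ Ioo (-C) C,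
        |(D x y - D x y') - (D x' y - D x' y')| ≤ M * |y - y'| * |x - x'|)
    (hint : ∀ x ∈ Ioo (-C) C, Integrable (D x) F)
    (hdeg : ∀ x ∈ Ioo (-C) C, ∫ y, D x y ∂F = 0)
    (hF : ∀ᵐ z ∂F, z ∈ Ioo (-C) C) {x : ℕ → ℝ} (hx : ∀ i, x i ∈ Ioo (-C) C) (hM : 0 ≤ M) (n : ℕ) :
    |∑ i ∈ Finset.range n, ∑ j ∈ Finset.range n, D (x i) (x j)| ≤
      M * (∫ s in Ioo (-C) C, |discrepancy F x n s|) ^ 2 := by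
  set A := ∫ s in Ioo (-C) C, |discrepancy F x n s|
  have hA : 0 ≤ A := integral_nonneg fun _ => abs_nonneg _
  have sec : ∀ z, Measurable (D z) := fun z => hmeas.comp measurable_prodMk_left
  have derivBound : ∀ {φ : ℝ → ℝ} {K : ℝ}, 0 ≤ K →
      (∀ y ∈ Ioo (-C) C, ∀ y' ∈ Ioo (-C) C, |φ y - φ y'| ≤ K * |y - y'|) →
      ∀ y ∈ Ioo (-C) C, |deriv φ y| ≤ K := by
    intro φ K hK hlip y hy
    refine norm_deriv_le_of_lip' (f := φ) hK ?_
    filter_upwards [isOpen_Ioo.mem_nhds hy] with y' hy' using hlip y' hy' y hy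
  have hdiff' : ∀ z ∈ Ioo (-C) C, ∀ y ∈ Ioo (-C) C, DifferentiableAt ℝ (D z) y :=
    fun z hz y hy => by
      have : D z = fun x => D x z := funext fun y => hsymm z y
      rw [this]
      exact hdiff y hy z hz
  set φ : ℝ → ℝ := fun z => ∑ j ∈ Finset.range n, D z (x j) with hφ
  -- The one-variable bound is applied to `D z - D z'`, whose mean is zero by degeneracy and whose
  -- derivative is at most `M |z - z'|`. Applying it again to `φ`, also of mean zero, produces the
  -- second factor `A`.
  have hlip : ∀ z ∈ Ioo (-C) C, ∀ z' ∈ Ioo (-C) C, |φ z - φ z'| ≤ M * A * |z - z'| := by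
    intro z hz z' hz'
    have h1 := abs_sum_sub_integral_le (F := F) (φ := fun y => D z y - D z' y) (M := M * |z - z'|)
      ((sec z).sub (sec z')) (fun y hy => (hdiff' z hz y hy).sub (hdiff' z' hz' y hy))
      (derivBound (by positivity) fun y hy y' hy' => by
        have := hmix z hz z' hz' y hy y' hy'
        rw [show D z y - D z' y - (D z y' - D z' y') = D z y - D z y' - (D z' y - D z' y') by ring]
        linarith) hF hx n
    rw [integral_sub (hint z hz) (hint z' hz'), hdeg z hz, hdeg z' hz'] at h1
    simp only [sub_zero, Finset.sum_sub_distrib] at h1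
    linarith
  have h2 := abs_sum_sub_integral_le (F := F) (φ := φ) (M := M * A)
    (Finset.measurable_sum _ fun j _ => hmeas.comp measurable_prodMk_right)
    (fun z hz => DifferentiableAt.fun_sum fun j _ => hdiff z hz _ (hx j))
    (derivBound (by positivity) hlip) hF hx n
  have h3 : ∫ z, φ z ∂F = 0 := by
    simp only [hφ]
    have e : ∀ j z, D z (x j) = D (x j) z := fun j z => hsymm _ _
    simp only [e]
    rw [integral_finsetSum _ fun j _ => hint _ (hx j)]
    exact Finset.sum_eq_zero fun j _ => hdeg _ (hx j)
  rw [h3] at h2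
  simp only [sub_zero] at h2
  refine h2.trans (le_of_eq (by ring))

end Discrepancy

/-! ### Covariances of indicators and the variance of the empirical process. -/

section EmpiricalProcess

open Set

variable {Ω : Type*} [MeasurableSpace Ω] {P : Measure Ω} {X : ℕ → Ω → ℝ} {C : ℝ}

lemma covariance_congr {f f' g g' : Ω → ℝ} (hf : f =ᵐ[P] f') (hg : g =ᵐ[P] g') :
    cov[f, g; P] = cov[f', g'; P] := by
  rw [covariance, covariance, integral_congr_ae hf, integral_congr_ae hg]
  refine integral_congr_ae ?_
  filter_upwards [hf, hg] with ω h1 h2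
  rw [h1, h2]

lemma abs_stepAbove_le_one (s z : ℝ) : |stepAbove s z| ≤ 1 := by
  unfold stepAbove
  split_ifs <;> simp

lemma stepAbove_nonneg (s z : ℝ) : 0 ≤ stepAbove s z := by
  unfold stepAbove
  split_ifs <;> simp

lemma stepAbove_antitone (z : ℝ) : Antitone fun s => stepAbove s z := by
  intro s s' hs
  simp only [stepAbove]
  split_ifs with h1 h2
  · rfl
  · exact absurd (hs.trans_lt h1) h2
  · exact zero_le_one
  · rfl

lemma integral_stepAbove_comp {Y : Ω → ℝ} (hY : Measurable Y) (s : ℝ) :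
    ∫ ω, stepAbove s (Y ω) ∂P = (P.map Y).real (Ioi s) := by
  rw [← integral_stepAbove, integral_map hY.aemeasurable
    (measurable_stepAbove_right s).aestronglyMeasurable]

variable [IsProbabilityMeasure P]

lemma memLp_stepAbove {Y : Ω → ℝ} (hY : Measurable Y) (s : ℝ) :
    MemLp (fun ω => stepAbove s (Y ω)) 2 P :=
  memLp_of_bound ((measurable_stepAbove_right s).comp hY) (fun _ => abs_stepAbove_le_one s _) 2

/-- The piecewise linear function rising from `0` at `s` to `1` at `s + δ`. -/
noncomputable def ramp (δ s z : ℝ) : ℝ := max 0 (min 1 ((z - s) / δ))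

lemma ramp_nonneg (δ s z : ℝ) : 0 ≤ ramp δ s z := le_max_left _ _

lemma abs_ramp_le_one (δ s z : ℝ) : |ramp δ s z| ≤ 1 := by
  rw [abs_of_nonneg (ramp_nonneg _ _ _)]
  exact max_le zero_le_one (min_le_left _ _)

lemma measurable_ramp (δ s : ℝ) : Measurable (ramp δ s) := by
  unfold ramp
  fun_prop

lemma ramp_le_stepAbove {δ : ℝ} (hδ : 0 < δ) (s z : ℝ) : ramp δ s z ≤ stepAbove s z := by
  unfold ramp stepAbove
  split_ifs with h
  · exact max_le zero_le_one (min_le_left _ _)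
  · exact max_le le_rfl ((min_le_right _ _).trans
      (div_nonpos_of_nonpos_of_nonneg (by linarith) hδ.le))

lemma stepAbove_add_le_ramp {δ : ℝ} (hδ : 0 < δ) (s z : ℝ) :
    stepAbove (s + δ) z ≤ ramp δ s z := by
  unfold ramp stepAbove
  split_ifs with h
  · refine le_max_of_le_right (le_min le_rfl ?_)
    rw [le_div_iff₀ hδ]
    linarith
  · exact le_max_left _ _

lemma abs_ramp_sub_le {δ : ℝ} (hδ : 0 < δ) (s z z' : ℝ) :
    |ramp δ s z' - ramp δ s z| ≤ |z' - z| / δ := by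
  unfold ramp
  refine (abs_max_sub_max_le_max _ _ _ _).trans ?_
  rw [sub_self, abs_zero, max_eq_right (abs_nonneg _)]
  refine (abs_min_sub_min_le_max _ _ _ _).trans ?_
  rw [sub_self, abs_zero, max_eq_right (abs_nonneg _), ← sub_div, abs_div, abs_of_pos hδ]
  simp

/-- Truncation to `[-C, C]`. -/
noncomputable def clamp (C z : ℝ) : ℝ := max (-C) (min C z)

lemma clamp_mono (C : ℝ) : Monotone (clamp C) := fun _ _ h =>
  max_le_max le_rfl (min_le_min le_rfl h)

lemma abs_clamp_le (hC : 0 < C) (z : ℝ) : |clamp C z| ≤ C :=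
  abs_le.2 ⟨le_max_left _ _, max_le (by linarith) (min_le_left _ _)⟩

lemma clamp_eq_self {z : ℝ} (hz : |z| < C) : clamp C z = z := by
  rw [abs_lt] at hz
  rw [clamp, min_eq_right hz.2.le, max_eq_right hz.1.le]

/-- The covariances of smoothed indicators are controlled by those of the variables. -/
lemma IsAssociatedSeq.cov_ramp_le (h : IsAssociatedSeq X P) (hX : ∀ n, Measurable (X n))
    (hC : 0 < C) (hb : ∀ n, ∀ᵐ ω ∂P, |X n ω| < C) {δ : ℝ} (hδ : 0 < δ) (s : ℝ) (j : ℕ) :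
    cov[fun ω => ramp δ s (X 0 ω), fun ω => ramp δ s (X j ω); P] ≤ cov[X 0, X j; P] / δ ^ 2 := by
  have mc := (clamp_mono C).measurable
  -- The dominating function `δ⁻¹ x` is unbounded. Clamping makes it a bounded functional and
  -- changes nothing almost surely.
  have cl : ∀ i, (fun ω => clamp C (X i ω)) =ᵐ[P] X i := fun i =>
    (hb i).mono fun ω hω => clamp_eq_self hω
  have clr : ∀ i, (fun ω => ramp δ s (clamp C (X i ω))) =ᵐ[P] fun ω => ramp δ s (X i ω) :=
    fun i => (cl i).fun_comp (ramp δ s)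
  have mono : ∀ {f : ℝ → ℝ}, (∀ z z', z ≤ z' → |f z' - f z| ≤ δ⁻¹ * clamp C z' - δ⁻¹ * clamp C z) →
      ∀ i, Monotone (fun x : ℕ → ℝ => δ⁻¹ * clamp C (x i) + f (x i)) ∧
        Monotone (fun x : ℕ → ℝ => δ⁻¹ * clamp C (x i) - f (x i)) := by
    intro f hf i
    constructor <;> intro x x' hx <;> have := abs_le.1 (hf _ _ (hx i)) <;> simp only <;> linarith
  have hr : ∀ z z', z ≤ z' → |ramp δ s (clamp C z') - ramp δ s (clamp C z)| ≤
      δ⁻¹ * clamp C z' - δ⁻¹ * clamp C z := fun _ _ hz => by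
    refine (abs_ramp_sub_le hδ s _ _).trans (le_of_eq ?_)
    rw [abs_of_nonneg (sub_nonneg.2 (clamp_mono C hz))]
    ring
  have cr : ∀ i, IsBoundedCylinder fun x => ramp δ s (clamp C (x i)) := fun i =>
    IsBoundedCylinder.eval (f := fun z => ramp δ s (clamp C z)) ((measurable_ramp δ s).comp mc)
      (fun _ => abs_ramp_le_one δ s _) i
  have cc : ∀ i, IsBoundedCylinder fun x => δ⁻¹ * clamp C (x i) := fun i =>
    (IsBoundedCylinder.eval mc (abs_clamp_le hC) i).const_mul δ⁻¹
  have key := h.abs_cov_le hX (cr 0) (cr j) (cc 0) (cc j) (mono hr 0).1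
    (mono hr 0).2 (mono hr j).1 (mono hr j).2
  rw [covariance_const_mul_left, covariance_const_mul_right, covariance_congr (cl 0) (cl j),
    covariance_congr (clr 0) (clr j)] at key
  refine (le_abs_self _).trans (key.trans (le_of_eq ?_))
  field_simp

lemma IsStationarySeq.cov_stepAbove_eq (h : IsStationarySeq X P) (hX : ∀ n, Measurable (X n))
    (s : ℝ) (j : ℕ) : cov[fun ω => stepAbove s (X 0 ω), fun ω => stepAbove s (X j ω); P] =
      ∫ ω, stepAbove s (X 0 ω) * stepAbove s (X j ω) ∂P - (P.map (X 0)).real (Ioi s) ^ 2 := by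
  rw [covariance_eq_sub (memLp_stepAbove (hX 0) s) (memLp_stepAbove (hX j) s),
    integral_stepAbove_comp (hX 0), integral_stepAbove_comp (hX j), h.map_eq j, sq]
  rfl

/-- Indicators are not Lipschitz, so each is replaced by a ramp of slope `1/δ`. The ramp lies
between the steps at `s + δ` and `s`, so each of the two replacements costs at most the mass of `(s,
s + δ]`. -/
lemma IsAssociatedSeq.cov_stepAbove_le (h : IsAssociatedSeq X P) (hst : IsStationarySeq X P)
    (hX : ∀ n, Measurable (X n)) (hC : 0 < C) (hb : ∀ n, ∀ᵐ ω ∂P, |X n ω| < C) {δ : ℝ}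
    (hδ : 0 < δ) (s : ℝ) (j : ℕ) :
    cov[fun ω => stepAbove s (X 0 ω), fun ω => stepAbove s (X j ω); P] ≤
      cov[X 0, X j; P] / δ ^ 2 +
        2 * ((P.map (X 0)).real (Ioi s) - (P.map (X 0)).real (Ioi (s + δ))) := by
  have hr := h.cov_ramp_le hX hC hb hδ s j
  have Lr : ∀ i, MemLp (fun ω => ramp δ s (X i ω)) 2 P := fun i =>
    memLp_of_bound ((measurable_ramp δ s).comp (hX i)) (fun _ => abs_ramp_le_one δ s _) 2
  have Ls : ∀ i s, MemLp (fun ω => stepAbove s (X i ω)) 2 P := fun i s => memLp_stepAbove (hX i) s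
  have Is : ∀ i s, Integrable (fun ω => stepAbove s (X i ω)) P := fun i s =>
    (Ls i s).integrable (by norm_num)
  have Ir : ∀ i, Integrable (fun ω => ramp δ s (X i ω)) P := fun i =>
    (Lr i).integrable (by norm_num)
  have hrj : ∫ ω, ramp δ s (X j ω) ∂P = ∫ ω, ramp δ s (X 0 ω) ∂P := by
    rw [← integral_map (hX j).aemeasurable (measurable_ramp δ s).aestronglyMeasurable,
      ← integral_map (hX 0).aemeasurable (measurable_ramp δ s).aestronglyMeasurable, hst.map_eq j]
  rw [covariance_eq_sub (Lr 0) (Lr j), hrj] at hr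
  simp only [Pi.mul_apply] at hr
  rw [hst.cov_stepAbove_eq hX]
  set q := (P.map (X 0)).real (Ioi s)
  set q' := (P.map (X 0)).real (Ioi (s + δ))
  set m := ∫ ω, ramp δ s (X 0 ω) ∂P
  have hm0 : 0 ≤ m := integral_nonneg fun _ => ramp_nonneg _ _ _
  have hmq : m ≤ q :=
    (integral_mono (Ir 0) (Is 0 s) fun ω => ramp_le_stepAbove hδ s _).trans_eq
      (integral_stepAbove_comp (hX 0) s)
  have hprod : ∫ ω, stepAbove s (X 0 ω) * stepAbove s (X j ω) ∂P ≤
      ∫ ω, (ramp δ s (X 0 ω) * ramp δ s (X j ω) +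
        ((stepAbove s (X 0 ω) - stepAbove (s + δ) (X 0 ω)) +
          (stepAbove s (X j ω) - stepAbove (s + δ) (X j ω)))) ∂P := by
    refine integral_mono ((Ls 0 s).integrable_mul (Ls j s))
      (((Lr 0).integrable_mul (Lr j)).add (((Is 0 s).sub (Is 0 _)).add ((Is j s).sub (Is j _))))
      fun ω => ?_
    have a1 := ramp_le_stepAbove hδ s (X 0 ω)
    have a2 := ramp_le_stepAbove hδ s (X j ω)
    have a3 := stepAbove_add_le_ramp hδ s (X 0 ω)
    have a4 := stepAbove_add_le_ramp hδ s (X j ω)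
    have a5 := (le_abs_self _).trans (abs_stepAbove_le_one s (X j ω))
    have a6 := (le_abs_self _).trans (abs_ramp_le_one δ s (X 0 ω))
    have a7 := ramp_nonneg δ s (X 0 ω)
    have a8 := stepAbove_nonneg s (X j ω)
    have b1 : (stepAbove s (X 0 ω) - ramp δ s (X 0 ω)) * stepAbove s (X j ω) ≤
        stepAbove s (X 0 ω) - ramp δ s (X 0 ω) := mul_le_of_le_one_right (by linarith) a5
    have b2 : ramp δ s (X 0 ω) * (stepAbove s (X j ω) - ramp δ s (X j ω)) ≤
        stepAbove s (X j ω) - ramp δ s (X j ω) := mul_le_of_le_one_left (by linarith) a6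
    simp only
    linarith
  have hsplit : ∫ ω, (ramp δ s (X 0 ω) * ramp δ s (X j ω) +
        ((stepAbove s (X 0 ω) - stepAbove (s + δ) (X 0 ω)) +
          (stepAbove s (X j ω) - stepAbove (s + δ) (X j ω)))) ∂P =
      ∫ ω, ramp δ s (X 0 ω) * ramp δ s (X j ω) ∂P + ((q - q') + (q - q')) := by
    have i1 : Integrable (fun ω => ramp δ s (X 0 ω) * ramp δ s (X j ω)) P :=
      (Lr 0).integrable_mul (Lr j)
    have i2 : ∀ i, Integrable (fun ω => stepAbove s (X i ω) - stepAbove (s + δ) (X i ω)) P :=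
      fun i => (Is i s).sub (Is i _)
    have i3 : Integrable (fun ω => (stepAbove s (X 0 ω) - stepAbove (s + δ) (X 0 ω)) +
        (stepAbove s (X j ω) - stepAbove (s + δ) (X j ω))) P := (i2 0).add (i2 j)
    rw [integral_add i1 i3, integral_add (i2 0) (i2 j),
      integral_sub (Is 0 s) (Is 0 _), integral_sub (Is j s) (Is j _),
      integral_stepAbove_comp (hX 0), integral_stepAbove_comp (hX 0), integral_stepAbove_comp (hX j),
      integral_stepAbove_comp (hX j), hst.map_eq j]
  -- Replacing the means needs no error term: `m ≤ q`, and the squared mean enters with a minus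
  -- sign.
  have hsq : m ^ 2 ≤ q ^ 2 := pow_le_pow_left₀ hm0 hmq 2
  rw [hsplit] at hprod
  linarith

/-- Translation reduces the integral to the tail over `[a, a + δ]` minus the tail over `[b, b + δ]`,
and tails lie in `[0, 1]`. No continuity of `F` is needed. -/
lemma integral_measureReal_Ioi_sub_le (F : Measure ℝ) [IsProbabilityMeasure F] {δ : ℝ}
    (hδ : 0 < δ) (a b : ℝ) :
    ∫ s in a..b, (F.real (Ioi s) - F.real (Ioi (s + δ))) ≤ δ := by
  have hq : Antitone fun s => F.real (Ioi s) := fun s t hst =>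
    measureReal_mono (Ioi_subset_Ioi hst)
  have hi : ∀ a b, IntervalIntegrable (fun s => F.real (Ioi s)) volume a b := fun a b =>
    hq.intervalIntegrable
  have hi' : IntervalIntegrable (fun s => F.real (Ioi (s + δ))) volume a b :=
    Antitone.intervalIntegrable fun s t hst => hq (by linarith)
  rw [intervalIntegral.integral_sub (hi a b) hi',
    intervalIntegral.integral_comp_add_right (f := fun s => F.real (Ioi s)) δ]
  have e1 := intervalIntegral.integral_add_adjacent_intervals (hi a (a + δ)) (hi (a + δ) (b + δ))
  have e2 := intervalIntegral.integral_add_adjacent_intervals (hi a b) (hi b (b + δ))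
  have h1 : ∫ s in a..(a + δ), F.real (Ioi s) ≤ ∫ _s in a..(a + δ), (1 : ℝ) :=
    intervalIntegral.integral_mono_on (by linarith) (hi _ _) intervalIntegrable_const
      fun s _ => measureReal_le_one
  have h2 : 0 ≤ ∫ s in b..(b + δ), F.real (Ioi s) :=
    intervalIntegral.integral_nonneg (by linarith) fun s _ => measureReal_nonneg
  simp only [intervalIntegral.integral_const, add_sub_cancel_left, smul_eq_mul, mul_one] at h1
  linarith

/-- Measurability in `s` comes from monotonicity: the joint and marginal tails are antitone. -/
lemma IsStationarySeq.integrableOn_cov_stepAbove (h : IsStationarySeq X P)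
    (hX : ∀ n, Measurable (X n)) (j : ℕ) :
    IntegrableOn (fun s => cov[fun ω => stepAbove s (X 0 ω), fun ω => stepAbove s (X j ω); P])
      (Ioo (-C) C) := by
  simp only [h.cov_stepAbove_eq hX]
  have h1 : Antitone fun s => ∫ ω, stepAbove s (X 0 ω) * stepAbove s (X j ω) ∂P := by
    intro s s' hs
    refine integral_mono ((memLp_stepAbove (hX 0) s').integrable_mul (memLp_stepAbove (hX j) s'))
      ((memLp_stepAbove (hX 0) s).integrable_mul (memLp_stepAbove (hX j) s)) fun ω => ?_
    exact mul_le_mul (stepAbove_antitone _ hs) (stepAbove_antitone _ hs) (stepAbove_nonneg _ _)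
      (stepAbove_nonneg _ _)
  have hp : IsProbabilityMeasure (P.map (X 0)) := Measure.isProbabilityMeasure_map (hX 0).aemeasurable
  refine Measure.integrableOn_of_bounded (M := 2) (by simp)
    (h1.measurable.sub (measurable_measureReal_Ioi.pow_const 2)).aestronglyMeasurable
    (ae_of_all _ fun s => ?_)
  have a1 : 0 ≤ ∫ ω, stepAbove s (X 0 ω) * stepAbove s (X j ω) ∂P :=
    integral_nonneg fun _ => mul_nonneg (stepAbove_nonneg _ _) (stepAbove_nonneg _ _)
  have a2 : ∫ ω, stepAbove s (X 0 ω) * stepAbove s (X j ω) ∂P ≤ ∫ _ω, (1 : ℝ) ∂P := by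
    refine integral_mono ((memLp_stepAbove (hX 0) s).integrable_mul (memLp_stepAbove (hX j) s))
      (integrable_const _) fun ω => ?_
    exact mul_le_one₀ ((le_abs_self _).trans (abs_stepAbove_le_one _ _)) (stepAbove_nonneg _ _)
      ((le_abs_self _).trans (abs_stepAbove_le_one _ _))
  have a3 : (P.map (X 0)).real (Ioi s) ^ 2 ≤ 1 := pow_le_one₀ measureReal_nonneg measureReal_le_one
  have a4 : 0 ≤ (P.map (X 0)).real (Ioi s) ^ 2 := by positivity
  simp only [integral_const, probReal_univ, smul_eq_mul, mul_one] at a2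
  rw [Real.norm_eq_abs, abs_le]
  constructor <;> linarith

/-- The integrated covariances of the indicators are at most of order `cov(X₀, X_j)^{1/3}`. -/
lemma IsAssociatedSeq.integral_cov_stepAbove_le (h : IsAssociatedSeq X P)
    (hst : IsStationarySeq X P) (hX : ∀ n, Measurable (X n)) (hC : 0 < C)
    (hb : ∀ n, ∀ᵐ ω ∂P, |X n ω| < C) {j : ℕ} (hc : 0 ≤ cov[X 0, X j; P]) :
    ∫ s in Ioo (-C) C, cov[fun ω => stepAbove s (X 0 ω), fun ω => stepAbove s (X j ω); P] ≤
      (2 * C + 2) * cov[X 0, X j; P] ^ (1 / 3 : ℝ) := by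
  have hp : IsProbabilityMeasure (P.map (X 0)) := Measure.isProbabilityMeasure_map (hX 0).aemeasurable
  set c := cov[X 0, X j; P]
  have key : ∀ δ > 0,
      ∫ s in Ioo (-C) C, cov[fun ω => stepAbove s (X 0 ω), fun ω => stepAbove s (X j ω); P] ≤
        2 * C * (c / δ ^ 2) + 2 * δ := by
    intro δ hδ
    have hi : IntegrableOn (fun s => (P.map (X 0)).real (Ioi s) - (P.map (X 0)).real (Ioi (s + δ)))
        (Ioo (-C) C) := by
      refine Measure.integrableOn_of_bounded (M := 1) (by simp)
        (measurable_measureReal_Ioi.sub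
          (measurable_measureReal_Ioi.comp (measurable_add_const δ))).aestronglyMeasurable
        (ae_of_all _ fun s => ?_)
      have := measureReal_nonneg (μ := P.map (X 0)) (s := Ioi s)
      have := measureReal_nonneg (μ := P.map (X 0)) (s := Ioi (s + δ))
      have := measureReal_le_one (μ := P.map (X 0)) (s := Ioi s)
      have := measureReal_le_one (μ := P.map (X 0)) (s := Ioi (s + δ))
      rw [Real.norm_eq_abs, abs_le]
      constructor <;> linarith
    have h1 := setIntegral_mono (hst.integrableOn_cov_stepAbove (C := C) hX j)
      ((integrable_const (c / δ ^ 2)).add (hi.const_mul 2))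
      fun s => h.cov_stepAbove_le hst hX hC hb hδ s j
    refine h1.trans ?_
    simp only [Pi.add_apply]
    rw [integral_add (integrable_const _) (hi.const_mul 2), integral_const_mul,
      ← integral_Ioc_eq_integral_Ioo, ← integral_Ioc_eq_integral_Ioo,
      ← intervalIntegral.integral_of_le (by linarith), ← intervalIntegral.integral_of_le (by linarith)]
    have := integral_measureReal_Ioi_sub_le (P.map (X 0)) hδ (-C) C
    simp only [intervalIntegral.integral_const, smul_eq_mul]
    linarith
  -- The choice `δ = c^{1/3}` balances `c / δ²` against `δ`. It is unavailable for `c = 0`, where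
  -- `δ` is sent to zero instead.
  rcases hc.eq_or_lt with h0 | h0
  · rw [← h0, Real.zero_rpow (by norm_num), mul_zero]
    refine le_of_forall_pos_le_add fun ε hε => ?_
    have := key (ε / 2) (half_pos hε)
    rw [← h0] at this
    simp only [zero_div, mul_zero, zero_add] at this ⊢
    linarith
  · have hδ : 0 < c ^ (1 / 3 : ℝ) := Real.rpow_pos_of_pos h0 _
    refine (key _ hδ).trans (le_of_eq ?_)
    have : c = (c ^ (1 / 3 : ℝ)) ^ 3 := by
      rw [← Real.rpow_natCast, ← Real.rpow_mul h0.le]; norm_num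
    have h2 : c / (c ^ (1 / 3 : ℝ)) ^ 2 = c ^ (1 / 3 : ℝ) := by
      nth_rewrite 1 [this]
      field_simp
    rw [h2]
    ring

lemma IsAssociatedSeq.cov_nonneg_of_bounded (h : IsAssociatedSeq X P)
    (hX : ∀ n, Measurable (X n)) (hC : 0 < C) (hb : ∀ n, ∀ᵐ ω ∂P, |X n ω| < C) (i j : ℕ) :
    0 ≤ cov[X i, X j; P] := by
  have cl : ∀ i, (fun ω => clamp C (X i ω)) =ᵐ[P] X i := fun i =>
    (hb i).mono fun ω hω => clamp_eq_self hω
  rw [← covariance_congr (cl i) (cl j)]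
  exact h.cov_nonneg hX (IsBoundedCylinder.eval (clamp_mono C).measurable (abs_clamp_le hC) i)
    (IsBoundedCylinder.eval (clamp_mono C).measurable (abs_clamp_le hC) j)
    (fun x x' hx => clamp_mono C (hx i)) fun x x' hx => clamp_mono C (hx j)

/-- The integrated variance of the empirical process is of linear order. -/
lemma IsAssociatedSeq.integral_variance_stepAbove_le (h : IsAssociatedSeq X P)
    (hst : IsStationarySeq X P) (hX : ∀ n, Measurable (X n)) (hC : 0 < C)
    (hb : ∀ n, ∀ᵐ ω ∂P, |X n ω| < C)
    (hs : Summable fun j : ℕ => cov[X 0, X j; P] ^ (1 / 3 : ℝ)) (n : ℕ) :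
    IntegrableOn (fun s => Var[fun ω => ∑ i ∈ Finset.range n, stepAbove s (X i ω); P])
        (Ioo (-C) C) ∧
      ∫ s in Ioo (-C) C, Var[fun ω => ∑ i ∈ Finset.range n, stepAbove s (X i ω); P] ≤
        2 * (2 * C + 2) * (∑' j : ℕ, cov[X 0, X j; P] ^ (1 / 3 : ℝ)) * n := by
  have hc := h.cov_nonneg_of_bounded hX hC hb
  have hI := hst.integrableOn_cov_stepAbove (C := C) hX
  have hle : ∀ j, ∫ s in Ioo (-C) C,
      cov[fun ω => stepAbove s (X 0 ω), fun ω => stepAbove s (X j ω); P] ≤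
        (2 * C + 2) * cov[X 0, X j; P] ^ (1 / 3 : ℝ) := fun j =>
    h.integral_cov_stepAbove_le hst hX hC hb (hc 0 j)
  have hr : ∀ j, 0 ≤ cov[X 0, X j; P] ^ (1 / 3 : ℝ) := fun j => Real.rpow_nonneg (hc 0 j) _
  induction n with
  | zero => simp [variance_fun_zero]
  | succ n ih =>
    have hrec : ∀ s, Var[fun ω => ∑ i ∈ Finset.range (n + 1), stepAbove s (X i ω); P] =
        Var[fun ω => ∑ i ∈ Finset.range n, stepAbove s (X i ω); P] +
        (cov[fun ω => stepAbove s (X 0 ω), fun ω => stepAbove s (X 0 ω); P] +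
          2 * ∑ j ∈ Finset.range n,
            cov[fun ω => stepAbove s (X 0 ω), fun ω => stepAbove s (X (j + 1) ω); P]) := fun s => by
      rw [hst.variance_sum_succ (measurable_stepAbove_right s) fun n => memLp_stepAbove (hX n) s,
        covariance_self (memLp_stepAbove (hX 0) s).aestronglyMeasurable.aemeasurable]
    simp only [hrec]
    have i2 : IntegrableOn (fun s => 2 * ∑ j ∈ Finset.range n,
        cov[fun ω => stepAbove s (X 0 ω), fun ω => stepAbove s (X (j + 1) ω); P]) (Ioo (-C) C) :=
      (integrable_finsetSum _ fun j _ => hI (j + 1)).const_mul 2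
    refine ⟨ih.1.add ((hI 0).add i2), ?_⟩
    have i3 : IntegrableOn (fun s =>
        cov[fun ω => stepAbove s (X 0 ω), fun ω => stepAbove s (X 0 ω); P] +
        2 * ∑ j ∈ Finset.range n,
          cov[fun ω => stepAbove s (X 0 ω), fun ω => stepAbove s (X (j + 1) ω); P])
        (Ioo (-C) C) := (hI 0).add i2
    rw [integral_add ih.1 i3, integral_add (hI 0) i2, integral_const_mul,
      integral_finsetSum _ fun j _ => hI (j + 1)]
    have h1 : ∑ j ∈ Finset.range n, ∫ s in Ioo (-C) C,
        cov[fun ω => stepAbove s (X 0 ω), fun ω => stepAbove s (X (j + 1) ω); P] ≤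
        ∑ j ∈ Finset.range n, (2 * C + 2) * cov[X 0, X (j + 1); P] ^ (1 / 3 : ℝ) :=
      Finset.sum_le_sum fun j _ => hle (j + 1)
    -- Positive lags carry weight two and lag zero weight one. Counting lag zero twice as well
    -- bounds the increment by twice the full series.
    have h2 := hs.sum_le_tsum (Finset.range (n + 1)) fun j _ => hr j
    rw [Finset.sum_range_succ'] at h2
    rw [← Finset.mul_sum] at h1
    have h3 := hle 0
    have h4 := ih.2
    have h5 := hr 0
    have h6 := mul_le_mul_of_nonneg_left h2 (by linarith : (0 : ℝ) ≤ 2 * (2 * C + 2))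
    have h7 : 0 ≤ (2 * C + 2) * cov[X 0, X 0; P] ^ (1 / 3 : ℝ) := by positivity
    push_cast
    linarith

/-- Cauchy–Schwarz on an interval of length `2C`, obtained from the nonnegative integral of the
squared deviation of `|G|` from its mean `A / (2C)`. -/
lemma sq_integral_abs_le {G : ℝ → ℝ} (hC : 0 < C) (hG : IntegrableOn G (Ioo (-C) C))
    (hG2 : IntegrableOn (fun s => G s ^ 2) (Ioo (-C) C)) :
    (∫ s in Ioo (-C) C, |G s|) ^ 2 ≤ 2 * C * ∫ s in Ioo (-C) C, G s ^ 2 := by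
  set A := ∫ s in Ioo (-C) C, |G s|
  have h0 : 0 ≤ ∫ s in Ioo (-C) C, (|G s| - A / (2 * C)) ^ 2 :=
    integral_nonneg fun _ => sq_nonneg _
  have e : ∀ s, (|G s| - A / (2 * C)) ^ 2 =
      G s ^ 2 - (A / C) * |G s| + (A / (2 * C)) ^ 2 := fun s => by
    rw [sub_sq, sq_abs]; field_simp
  simp only [e] at h0
  have i1 : IntegrableOn (fun s => A / C * |G s|) (Ioo (-C) C) := hG.abs.const_mul _
  have i2 : IntegrableOn (fun _ : ℝ => (A / (2 * C)) ^ 2) (Ioo (-C) C) := integrable_const _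
  have i3 : IntegrableOn (fun s => G s ^ 2 - A / C * |G s|) (Ioo (-C) C) := hG2.sub i1
  rw [integral_add i3 i2, integral_sub hG2 i1, integral_const_mul] at h0
  simp only [integral_const, MeasurableSet.univ, measureReal_restrict_apply, univ_inter,
    Real.volume_real_Ioo_of_le (by linarith : -C ≤ C), smul_eq_mul] at h0
  have h1 : ∫ s in Ioo (-C) C, |G s| = A := rfl
  rw [h1] at h0
  have h2 := mul_nonneg h0 (by linarith : 0 ≤ 2 * C)
  have h3 : (∫ s in Ioo (-C) C, G s ^ 2) * (2 * C) - A ^ 2 =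
      ((∫ s in Ioo (-C) C, G s ^ 2) - A / C * A + (C - -C) * (A / (2 * C)) ^ 2) * (2 * C) := by
    field_simp
    ring
  linarith

/-- The degenerate part of a `V`-statistic is of order `n` in `L¹`. -/
lemma IsAssociatedSeq.integral_abs_sum_sum_le (h : IsAssociatedSeq X P)
    (hst : IsStationarySeq X P) (hX : ∀ n, Measurable (X n)) (hC : 0 < C)
    (hb : ∀ n, ∀ᵐ ω ∂P, |X n ω| < C)
    (hs : Summable fun j : ℕ => cov[X 0, X j; P] ^ (1 / 3 : ℝ))
    {D : ℝ → ℝ → ℝ} {M : ℝ} (hM : 0 ≤ M) (hD : ∀ x : ℕ → ℝ, (∀ i, x i ∈ Ioo (-C) C) → ∀ n,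
      |∑ i ∈ Finset.range n, ∑ j ∈ Finset.range n, D (x i) (x j)| ≤
        M * (∫ s in Ioo (-C) C, |discrepancy (P.map (X 0)) x n s|) ^ 2) :
    ∃ K, ∀ n : ℕ, ∫ ω, |∑ i ∈ Finset.range n, ∑ j ∈ Finset.range n, D (X i ω) (X j ω)| ∂P ≤
      K * n := by
  have hp : IsProbabilityMeasure (P.map (X 0)) := Measure.isProbabilityMeasure_map (hX 0).aemeasurable
  refine ⟨M * (2 * C) * (2 * (2 * C + 2) * ∑' j : ℕ, cov[X 0, X j; P] ^ (1 / 3 : ℝ)), fun n => ?_⟩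
  have hall : ∀ᵐ ω ∂P, ∀ i, X i ω ∈ Ioo (-C) C := by
    rw [ae_all_iff]
    exact fun i => (hb i).mono fun ω hω => abs_lt.1 hω
  set G : Ω → ℝ → ℝ := fun ω s => discrepancy (P.map (X 0)) (fun i => X i ω) n s with hG
  have hGm : Measurable fun p : Ω × ℝ => G p.1 p.2 := by
    simp only [hG, discrepancy]
    refine Finset.measurable_sum _ fun i _ => Measurable.sub ?_
      (measurable_measureReal_Ioi.comp measurable_snd)
    exact measurable_stepAbove.comp (measurable_snd.prodMk ((hX i).comp measurable_fst))
  have hGint : Integrable (fun p : Ω × ℝ => G p.1 p.2 ^ 2)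
      (P.prod (volume.restrict (Ioo (-C) C))) := by
    refine Integrable.of_bound (hGm.pow_const 2).aestronglyMeasurable ((n : ℝ) ^ 2)
      (ae_of_all _ fun p => ?_)
    rw [norm_pow]
    exact pow_le_pow_left₀ (norm_nonneg _) (abs_discrepancy_le _ n _) 2
  have hpt : ∀ᵐ ω ∂P, |∑ i ∈ Finset.range n, ∑ j ∈ Finset.range n, D (X i ω) (X j ω)| ≤
      M * (2 * C) * ∫ s in Ioo (-C) C, G ω s ^ 2 := by
    filter_upwards [hall] with ω hω
    refine (hD _ hω n).trans ?_
    rw [mul_assoc]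
    refine mul_le_mul_of_nonneg_left (sq_integral_abs_le hC (integrableOn_discrepancy _ n) ?_) hM
    refine Measure.integrableOn_of_bounded (M := (n : ℝ) ^ 2) (by simp)
      ((measurable_discrepancy _ n).pow_const 2).aestronglyMeasurable (ae_of_all _ fun s => ?_)
    rw [norm_pow]
    exact pow_le_pow_left₀ (norm_nonneg _) (abs_discrepancy_le _ n _) 2
  refine (integral_mono_of_nonneg (ae_of_all _ fun _ => abs_nonneg _)
    (hGint.integral_prod_left.const_mul _) hpt).trans ?_
  rw [integral_const_mul, integral_integral_swap (f := fun ω s => G ω s ^ 2) hGint,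
    mul_assoc (M * (2 * C))]
  refine mul_le_mul_of_nonneg_left ?_ (by positivity)
  -- Under `P` the discrepancy is the centred count, so its second moment is a variance.
  have hvar : ∀ s, ∫ ω, G ω s ^ 2 ∂P =
      Var[fun ω => ∑ i ∈ Finset.range n, stepAbove s (X i ω); P] := fun s => by
    have hm : Measurable fun ω => ∑ i ∈ Finset.range n, stepAbove s (X i ω) :=
      Finset.measurable_sum _ fun i _ => (measurable_stepAbove_right s).comp (hX i)
    rw [variance_eq_integral hm.aemeasurable, integral_finsetSum _ fun i _ =>
      (memLp_stepAbove (hX i) s).integrable (by norm_num)]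
    simp only [integral_stepAbove_comp (hX _), hst.map_eq, hG, discrepancy,
      Finset.sum_sub_distrib]
  simp only [hvar]
  exact (h.integral_variance_stepAbove_le hst hX hC hb hs n).2

end EmpiricalProcess

/-! ### Bounds on the kernel and near-monotonicity of its projection. -/

section Kernel

open Set

variable {ρ : ℝ → ℝ → ℝ} {C : ℝ}

lemma abs_le_of_monotoneOn_or_antitoneOn {f : ℝ → ℝ} {a b x : ℝ}
    (hf : MonotoneOn f (Icc a b) ∨ AntitoneOn f (Icc a b)) (hx : x ∈ Icc a b) :
    |f x| ≤ max |f a| |f b| := by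
  have ha : a ∈ Icc a b := left_mem_Icc.2 (hx.1.trans hx.2)
  have hb : b ∈ Icc a b := right_mem_Icc.2 (hx.1.trans hx.2)
  rcases hf with hf | hf
  · exact abs_le_max_abs_abs (hf ha hx hx.1) (hf hx hb hx.2)
  · rw [max_comm]
    exact abs_le_max_abs_abs (hf hx hb hx.2) (hf ha hx hx.1)

/-- A symmetric kernel with monotone sections is bounded on the square. -/
lemma exists_bound_of_monotone_sections (hsymm : ∀ x y, ρ x y = ρ y x) (hC : 0 < C)
    (hmono : ∀ y ∈ Icc (-C) C, MonotoneOn (fun x => ρ x y) (Icc (-C) C) ∨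
      AntitoneOn (fun x => ρ x y) (Icc (-C) C)) :
    ∃ B, 0 ≤ B ∧ ∀ x ∈ Icc (-C) C, ∀ y ∈ Icc (-C) C, |ρ x y| ≤ B := by
  -- Monotonicity in the first variable reduces to `x = ±C`. By symmetry these are again monotone
  -- sections, so the corners decide.
  refine ⟨max (max |ρ (-C) (-C)| |ρ C (-C)|) (max |ρ (-C) C| |ρ C C|), by positivity,
    fun x hx y hy => ?_⟩
  have hl : -C ∈ Icc (-C) C := ⟨le_rfl, by linarith⟩
  have hr : C ∈ Icc (-C) C := ⟨by linarith, le_rfl⟩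
  have h1 := abs_le_of_monotoneOn_or_antitoneOn (hmono y hy) hx
  have h2 := abs_le_of_monotoneOn_or_antitoneOn (hmono (-C) hl) hy
  have h3 := abs_le_of_monotoneOn_or_antitoneOn (hmono C hr) hy
  rw [hsymm (-C) y, hsymm C y] at h1
  exact h1.trans (max_le_max h2 h3)

variable {F : Measure ℝ} {B : ℝ}

lemma hoeffding2_symm (hsymm : ∀ x y, ρ x y = ρ y x) (x y : ℝ) :
    hoeffding2 ρ F x y = hoeffding2 ρ F y x := by
  simp only [hoeffding2, hsymm x y]
  ring

/-- Up to a linear function, the first projection is monotone on the open interval. -/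
lemma rho1_add_linear_monotoneOn {M : ℝ}
    (hmono : MonotoneOn (fun x => ρ x 0) (Icc (-C) C) ∨ AntitoneOn (fun x => ρ x 0) (Icc (-C) C))
    (hlip : ∀ x ∈ Ioo (-C) C, ∀ x' ∈ Ioo (-C) C,
      |hoeffding2 ρ F x 0 - hoeffding2 ρ F x' 0| ≤ M * |x - x'|) (c : ℝ) :
    MonotoneOn (fun x => (rho1 ρ F x - c) + M * x) (Ioo (-C) C) ∨
      MonotoneOn (fun x => -(rho1 ρ F x - c) + M * x) (Ioo (-C) C) := by
  -- Up to a constant, `h⁽²⁾(·, 0)` is `ρ(·, 0) - ρ₁`, so its Lipschitz bound says that `ρ₁` follows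
  -- the monotone function `ρ(·, 0)` up to slope `M`.
  have key : ∀ x ∈ Ioo (-C) C, ∀ x' ∈ Ioo (-C) C, x ≤ x' →
      |(ρ x' 0 - ρ x 0) - (rho1 ρ F x' - rho1 ρ F x)| ≤ M * (x' - x) := by
    intro x hx x' hx' hxx
    have := hlip x' hx' x hx
    rw [abs_of_nonneg (sub_nonneg.2 hxx)] at this
    simp only [hoeffding2] at this
    convert this using 2
    ring
  refine hmono.imp (fun h x hx x' hx' hxx => ?_) fun h x hx x' hx' hxx => ?_
  all_goals
    have h1 := abs_le.1 (key x hx x' hx' hxx)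
    have h2 := h (Ioo_subset_Icc_self hx) (Ioo_subset_Icc_self hx') hxx
    simp only at h2 ⊢
    linarith [h1.1, h1.2]

variable [IsProbabilityMeasure F]

lemma measurable_rho1 (hρ : Measurable fun p : ℝ × ℝ => ρ p.1 p.2) : Measurable (rho1 ρ F) :=
  (hρ.stronglyMeasurable.integral_prod_right (ν := F)).measurable

lemma measurable_hoeffding2 (hρ : Measurable fun p : ℝ × ℝ => ρ p.1 p.2) :
    Measurable fun p : ℝ × ℝ => hoeffding2 ρ F p.1 p.2 :=
  ((hρ.sub ((measurable_rho1 hρ).comp measurable_fst)).sub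
    ((measurable_rho1 hρ).comp measurable_snd)).add_const _

lemma abs_rho1_le (hF : ∀ᵐ z ∂F, z ∈ Ioo (-C) C)
    (hB : ∀ x ∈ Ioo (-C) C, ∀ y ∈ Ioo (-C) C, |ρ x y| ≤ B) {x : ℝ} (hx : x ∈ Ioo (-C) C) :
    |rho1 ρ F x| ≤ B := by
  have := norm_integral_le_of_norm_le_const (f := ρ x) (C := B) (hF.mono fun z hz => hB x hx z hz)
  simpa [rho1] using this

lemma integrable_section (hρ : Measurable fun p : ℝ × ℝ => ρ p.1 p.2)
    (hF : ∀ᵐ z ∂F, z ∈ Ioo (-C) C) (hB : ∀ x ∈ Ioo (-C) C, ∀ y ∈ Ioo (-C) C, |ρ x y| ≤ B) {x : ℝ}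
    (hx : x ∈ Ioo (-C) C) : Integrable (ρ x) F :=
  Integrable.of_bound (hρ.comp measurable_prodMk_left).aestronglyMeasurable B
    (hF.mono fun z hz => hB x hx z hz)

lemma integrable_rho1 (hρ : Measurable fun p : ℝ × ℝ => ρ p.1 p.2)
    (hF : ∀ᵐ z ∂F, z ∈ Ioo (-C) C) (hB : ∀ x ∈ Ioo (-C) C, ∀ y ∈ Ioo (-C) C, |ρ x y| ≤ B) :
    Integrable (rho1 ρ F) F :=
  Integrable.of_bound (measurable_rho1 hρ).aestronglyMeasurable B
    (hF.mono fun _ hz => abs_rho1_le hF hB hz)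

lemma integral_rho1 (hρ : Measurable fun p : ℝ × ℝ => ρ p.1 p.2)
    (hF : ∀ᵐ z ∂F, z ∈ Ioo (-C) C) (hB : ∀ x ∈ Ioo (-C) C, ∀ y ∈ Ioo (-C) C, |ρ x y| ≤ B) :
    ∫ x, rho1 ρ F x ∂F = theta ρ F := by
  have hint : Integrable (fun p : ℝ × ℝ => ρ p.1 p.2) (F.prod F) := by
    refine Integrable.of_bound hρ.aestronglyMeasurable B ?_
    filter_upwards [Measure.quasiMeasurePreserving_fst.ae hF,
      Measure.quasiMeasurePreserving_snd.ae hF] with p h1 h2 using hB _ h1 _ h2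
  rw [theta, integral_prod _ hint]
  rfl

lemma abs_theta_le (hρ : Measurable fun p : ℝ × ℝ => ρ p.1 p.2)
    (hF : ∀ᵐ z ∂F, z ∈ Ioo (-C) C) (hB : ∀ x ∈ Ioo (-C) C, ∀ y ∈ Ioo (-C) C, |ρ x y| ≤ B) :
    |theta ρ F| ≤ B := by
  rw [← integral_rho1 hρ hF hB]
  have := norm_integral_le_of_norm_le_const (f := rho1 ρ F) (C := B)
    (hF.mono fun z hz => abs_rho1_le hF hB hz)
  simpa using this

lemma integral_hoeffding2 (hρ : Measurable fun p : ℝ × ℝ => ρ p.1 p.2)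
    (hF : ∀ᵐ z ∂F, z ∈ Ioo (-C) C) (hB : ∀ x ∈ Ioo (-C) C, ∀ y ∈ Ioo (-C) C, |ρ x y| ≤ B) {x : ℝ}
    (hx : x ∈ Ioo (-C) C) :
    Integrable (hoeffding2 ρ F x) F ∧ ∫ y, hoeffding2 ρ F x y ∂F = 0 := by
  have i1 := integrable_section hρ hF hB hx
  have i2 := integrable_rho1 hρ hF hB
  have i3 : Integrable (fun y => ρ x y - rho1 ρ F x) F := i1.sub (integrable_const _)
  have i4 : Integrable (fun y => ρ x y - rho1 ρ F x - rho1 ρ F y) F := i3.sub i2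
  refine ⟨i4.add (integrable_const _), ?_⟩
  simp only [hoeffding2]
  rw [integral_add i4 (integrable_const _), integral_sub i3 i2, integral_sub i1 (integrable_const _),
    integral_rho1 hρ hF hB]
  simp [rho1]

lemma abs_hoeffding2_le (hρ : Measurable fun p : ℝ × ℝ => ρ p.1 p.2)
    (hF : ∀ᵐ z ∂F, z ∈ Ioo (-C) C) (hB : ∀ x ∈ Ioo (-C) C, ∀ y ∈ Ioo (-C) C, |ρ x y| ≤ B) {x y : ℝ}
    (hx : x ∈ Ioo (-C) C) (hy : y ∈ Ioo (-C) C) : |hoeffding2 ρ F x y| ≤ 4 * B := by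
  have h1 := abs_le.1 (hB x hx y hy)
  have h2 := abs_le.1 (abs_rho1_le hF hB hx)
  have h3 := abs_le.1 (abs_rho1_le hF hB hy)
  have h4 := abs_le.1 (abs_theta_le hρ hF hB)
  rw [hoeffding2, abs_le]
  constructor <;> linarith [h1.1, h1.2, h2.1, h2.2, h3.1, h3.2, h4.1, h4.2]

/-- Association requires test functions that are monotone on the whole line, while the kernel is
controlled only inside the interval. Clamping the argument keeps the extension bounded. -/
lemma exists_monotone_bounded_extension {g : ℝ → ℝ} (hC : 0 < C) (hg : MonotoneOn g (Ioo (-C) C))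
    (hB : ∀ x ∈ Ioo (-C) C, |g x| ≤ B) :
    ∃ g' : ℝ → ℝ, Monotone g' ∧ (∃ B', ∀ x, |g' x| ≤ B') ∧ EqOn g' g (Ioo (-C) C) := by
  obtain ⟨e, he, heq⟩ := hg.exists_monotone_extension
    ⟨-B, by rintro _ ⟨x, hx, rfl⟩; exact (abs_le.1 (hB x hx)).1⟩
    ⟨B, by rintro _ ⟨x, hx, rfl⟩; exact (abs_le.1 (hB x hx)).2⟩
  refine ⟨fun x => e (clamp C x), he.comp (clamp_mono C), ⟨max |e (-C)| |e C|, fun x => ?_⟩,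
    fun x hx => ?_⟩
  · have := abs_le.1 (abs_clamp_le hC x)
    exact abs_le_max_abs_abs (he this.1) (he this.2)
  · simp only
    rw [clamp_eq_self (abs_lt.2 hx), heq hx]

/-- A bounded function that is monotone up to a linear function extends to a difference of bounded
monotone functions, and is dominated by their sum. -/
lemma exists_dominated_extension {g : ℝ → ℝ} {M : ℝ} (hC : 0 < C) (hM : 0 ≤ M)
    (hg : MonotoneOn (fun x => g x + M * x) (Ioo (-C) C) ∨
      MonotoneOn (fun x => -g x + M * x) (Ioo (-C) C)) (hB : ∀ x ∈ Ioo (-C) C, |g x| ≤ B) :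
    ∃ y w : ℝ → ℝ, Measurable y ∧ Measurable w ∧ (∃ B', ∀ x, |y x| ≤ B') ∧ (∃ B', ∀ x, |w x| ≤ B') ∧
      (∀ x x', x ≤ x' → |y x' - y x| ≤ w x' - w x) ∧ EqOn y g (Ioo (-C) C) ∧
      ∃ ε : ℝ, ε ^ 2 = 1 ∧ ∀ x ∈ Ioo (-C) C, w x = ε * y x + 2 * M * x := by
  have lin : ∀ x ∈ Ioo (-C) C, |M * x| ≤ M * C := fun x hx => by
    rw [abs_mul, abs_of_nonneg hM]
    exact mul_le_mul_of_nonneg_left (abs_lt.2 hx).le hM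
  have ml : Monotone fun x => M * clamp C x := (clamp_mono C).const_mul hM
  have bl : ∀ x, |M * clamp C x| ≤ M * C := fun x => by
    rw [abs_mul, abs_of_nonneg hM]
    exact mul_le_mul_of_nonneg_left (abs_clamp_le hC x) hM
  have dom : ∀ {a b : ℝ → ℝ}, Monotone a → Monotone b → ∀ x x', x ≤ x' →
      |(b x' - a x') - (b x - a x)| ≤ (a x' + b x') - (a x + b x) := fun ha hb x x' hx => by
    have := ha hx
    have := hb hx
    rw [abs_le]
    constructor <;> linarith
  -- One bounded monotone function extends `±g + M x` and the other is `M` times the clamp. Their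
  -- suitable difference is `y` and their sum is `w`, so `ε` records the sign.
  rcases hg with hg | hg
  · obtain ⟨b, mb, ⟨B', hB'⟩, hb⟩ := exists_monotone_bounded_extension (B := B + M * C) hC hg
      fun x hx => (abs_add_le _ _).trans (add_le_add (hB x hx) (lin x hx))
    refine ⟨fun x => b x - M * clamp C x, fun x => M * clamp C x + b x,
      mb.measurable.sub ml.measurable, ml.measurable.add mb.measurable,
      ⟨B' + M * C, fun x => (abs_sub _ _).trans (add_le_add (hB' x) (bl x))⟩,
      ⟨M * C + B', fun x => (abs_add_le _ _).trans (add_le_add (bl x) (hB' x))⟩,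
      dom ml mb, fun x hx => ?_, 1, one_pow 2, fun x hx => ?_⟩
    · simp only [hb hx, clamp_eq_self (abs_lt.2 hx)]
      ring
    · simp only [clamp_eq_self (abs_lt.2 hx)]
      ring
  · obtain ⟨a, ma, ⟨B', hB'⟩, ha⟩ := exists_monotone_bounded_extension (B := B + M * C) hC hg
      fun x hx => (abs_add_le _ _).trans (add_le_add (by rw [abs_neg]; exact hB x hx) (lin x hx))
    refine ⟨fun x => M * clamp C x - a x, fun x => a x + M * clamp C x,
      ml.measurable.sub ma.measurable, ma.measurable.add ml.measurable,
      ⟨M * C + B', fun x => (abs_sub _ _).trans (add_le_add (bl x) (hB' x))⟩,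
      ⟨B' + M * C, fun x => (abs_add_le _ _).trans (add_le_add (hB' x) (bl x))⟩,
      dom ma ml, fun x hx => ?_, -1, by norm_num, fun x hx => ?_⟩
    · simp only [ha hx, clamp_eq_self (abs_lt.2 hx)]
      ring
    · simp only [clamp_eq_self (abs_lt.2 hx)]
      ring

end Kernel

/-! ### Hoeffding decomposition and auxiliary estimates. -/

section UStatistic

lemma sum_sum_range_eq {D : ℕ → ℕ → ℝ} (hD : ∀ i j, D i j = D j i) (n : ℕ) :
    ∑ i ∈ Finset.range n, ∑ j ∈ Finset.range n, D i j =
      2 * ∑ j ∈ Finset.range n, ∑ i ∈ Finset.range j, D i j + ∑ i ∈ Finset.range n, D i i := by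
  induction n with
  | zero => simp
  | succ n ih =>
    simp only [Finset.sum_range_succ, Finset.sum_add_distrib]
    rw [ih, Finset.sum_congr rfl fun j _ => hD n j]
    ring

lemma sum_sum_add_eq (f : ℕ → ℝ) (n : ℕ) :
    ∑ j ∈ Finset.range n, ∑ i ∈ Finset.range j, (f i + f j) =
      ((n : ℝ) - 1) * ∑ i ∈ Finset.range n, f i := by
  induction n with
  | zero => simp
  | succ n ih =>
    rw [Finset.sum_range_succ, ih, Finset.sum_add_distrib, Finset.sum_range_succ]
    simp
    ring

lemma sum_sum_const_eq (c : ℝ) (n : ℕ) :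
    ∑ j ∈ Finset.range n, ∑ _i ∈ Finset.range j, c = (n.choose 2 : ℕ) * c := by
  simp only [Finset.sum_const, Finset.card_range, nsmul_eq_mul]
  rw [← Finset.sum_mul, ← Nat.cast_sum, Finset.sum_range_id, Nat.choose_two_right]

variable {Ω : Type*} {X : ℕ → Ω → ℝ}

/-- The Hoeffding decomposition of the `U`-statistic. -/
lemma uStat_sub_theta_eq (ρ : ℝ → ℝ → ℝ) (F : Measure ℝ) {n : ℕ} (hn : 2 ≤ n) (ω : Ω) :
    uStat ρ X n ω - theta ρ F =
      2 / n * ∑ i ∈ Finset.range n, (rho1 ρ F (X i ω) - theta ρ F) +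
        2 / (n * (n - 1)) * ∑ j ∈ Finset.range n, ∑ i ∈ Finset.range j,
          hoeffding2 ρ F (X i ω) (X j ω) := by
  have hn' : (2 : ℝ) ≤ n := by exact_mod_cast hn
  have h1 : (n : ℝ) - 1 ≠ 0 := by linarith
  have h0 : (n : ℝ) ≠ 0 := by linarith
  have e : ∀ i j, ρ (X i ω) (X j ω) = hoeffding2 ρ F (X i ω) (X j ω) +
      ((rho1 ρ F (X i ω) - theta ρ F) + (rho1 ρ F (X j ω) - theta ρ F)) + theta ρ F := fun i j => by
    rw [hoeffding2]; ring
  rw [uStat]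
  simp only [e]
  rw [Finset.sum_congr rfl fun j _ => (Finset.sum_add_distrib.trans
    (congrArg (· + _) Finset.sum_add_distrib))]
  rw [Finset.sum_add_distrib, Finset.sum_add_distrib,
    sum_sum_add_eq fun i => rho1 ρ F (X i ω) - theta ρ F, sum_sum_const_eq, Nat.cast_choose_two]
  field_simp
  ring

variable [MeasurableSpace Ω] {P : Measure Ω} [IsProbabilityMeasure P]

/-- Parallelogram identity, with the variance of the difference dropped. -/
lemma variance_const_mul_add_le {S T : Ω → ℝ} (hS : MemLp S 2 P) (hT : MemLp T 2 P) {ε : ℝ}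
    (hε : ε ^ 2 = 1) (c : ℝ) :
    Var[fun ω => ε * S ω + c * T ω; P] ≤ 2 * Var[S; P] + 2 * c ^ 2 * Var[T; P] := by
  have h1 := variance_fun_add (hS.const_mul ε) (hT.const_mul c)
  have h2 := variance_fun_sub (hS.const_mul ε) (hT.const_mul c)
  have h3 := variance_nonneg (fun ω => ε * S ω - c * T ω) P
  rw [variance_const_mul, variance_const_mul, hε] at h1 h2
  linarith

lemma exists_le_mul_of_tendsto_div {V : ℕ → ℝ} (h0 : V 0 = 0) {l : ℝ}
    (h : Tendsto (fun n : ℕ => V n / n) atTop (nhds l)) : ∃ K, ∀ n : ℕ, V n ≤ K * n := by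
  obtain ⟨K, hK⟩ := h.bddAbove_range
  refine ⟨K, fun n => ?_⟩
  rcases Nat.eq_zero_or_pos n with rfl | hn
  · simp [h0]
  · exact (div_le_iff₀ (by exact_mod_cast hn)).1 (hK ⟨n, rfl⟩)

/-- Each term is its cube root times a bounded factor. The summability gives linear growth of the
variance of `∑ X_i`, needed for the `2 M x` part of `w`. -/
lemma summable_of_summable_rpow {c : ℕ → ℝ} (hc : ∀ j, 0 ≤ c j)
    (h : Summable fun j => c j ^ (1 / 3 : ℝ)) : Summable c := by
  have hr : ∀ j, 0 ≤ c j ^ (1 / 3 : ℝ) := fun j => Real.rpow_nonneg (hc j) _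
  refine Summable.of_nonneg_of_le hc (fun j => ?_) (h.mul_left ((∑' j, c j ^ (1 / 3 : ℝ)) ^ 2))
  have h1 : c j ^ (1 / 3 : ℝ) ≤ ∑' j, c j ^ (1 / 3 : ℝ) := h.le_tsum j fun i _ => hr i
  have h2 : c j = (c j ^ (1 / 3 : ℝ)) ^ 2 * c j ^ (1 / 3 : ℝ) := by
    rw [← pow_succ, ← Real.rpow_natCast, ← Real.rpow_mul (hc j)]; norm_num
  calc c j = (c j ^ (1 / 3 : ℝ)) ^ 2 * c j ^ (1 / 3 : ℝ) := h2
    _ ≤ _ := mul_le_mul_of_nonneg_right (pow_le_pow_left₀ (hr j) h1 2) (hr j)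

end UStatistic

end AssocU

/-! ### The central limit theorem for the U-statistic. -/

open AssocU in
theorem theorem3p3 {Ω : Type*} [MeasurableSpace Ω] (P : Measure Ω) [IsProbabilityMeasure P]
    (X : ℕ → Ω → ℝ) (hX : ∀ n, Measurable (X n))
    (hstat : AssocU.IsStationarySeq X P) (hassoc : AssocU.IsAssociatedSeq X P)
    (C : ℝ) (hC : 0 < C) (hbdd : ∀ n, ∀ᵐ ω ∂P, |X n ω| < C)
    (hcov : Summable (fun j : ℕ => cov[X 0, X j; P] ^ (1 / 3 : ℝ)))
    (ρ : ℝ → ℝ → ℝ) (hρ : Measurable (fun p : ℝ × ℝ => ρ p.1 p.2))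
    (hsymm : ∀ x y, ρ x y = ρ y x)
    (hsmooth : AssocU.HasBoundedSecondPartialsOn
      (fun v : Fin 4 → ℝ => AssocU.hoeffding2 ρ (P.map (X 0)) (v 0) (v 1) *
        AssocU.hoeffding2 ρ (P.map (X 0)) (v 2) (v 3))
      {v : Fin 4 → ℝ | ∀ k, v k ∈ Set.Ioo (-C) C})
    (hvar : 0 < Var[fun ω => AssocU.rho1 ρ (P.map (X 0)) (X 0 ω); P])
    (hsum : Summable (fun j : ℕ =>
      cov[fun ω => AssocU.rho1 ρ (P.map (X 0)) (X 0 ω),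
        fun ω => AssocU.rho1 ρ (P.map (X 0)) (X (j + 1) ω); P]))
    (hmono : ∀ y ∈ Set.Icc (-C) C,
      MonotoneOn (fun x => ρ x y) (Set.Icc (-C) C) ∨
        AntitoneOn (fun x => ρ x y) (Set.Icc (-C) C))
    (hσ : 0 < AssocU.sigmaUSq ρ X P) :
    TendstoInDistribution
      (fun (n : ℕ) (ω : Ω) =>
        Real.sqrt n * (AssocU.uStat ρ X n ω - AssocU.theta ρ (P.map (X 0))) /
          (2 * Real.sqrt (AssocU.sigmaUSq ρ X P)))
      atTop (id : ℝ → ℝ) (fun _ => P) (gaussianReal 0 1) := by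
  set F := P.map (X 0) with hFdef
  have hp : IsProbabilityMeasure F := Measure.isProbabilityMeasure_map (hX 0).aemeasurable
  have hF : ∀ᵐ z ∂F, z ∈ Set.Ioo (-C) C := by
    refine (ae_map_iff (hX 0).aemeasurable measurableSet_Ioo).2 ?_
    exact (hbdd 0).mono fun ω hω => abs_lt.1 hω
  have hI : ∀ n, ∀ᵐ ω ∂P, X n ω ∈ Set.Ioo (-C) C := fun n =>
    (hbdd n).mono fun ω hω => abs_lt.1 hω
  obtain ⟨B, hB0, hB'⟩ := exists_bound_of_monotone_sections hsymm hC hmono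
  have hB : ∀ x ∈ Set.Ioo (-C) C, ∀ y ∈ Set.Ioo (-C) C, |ρ x y| ≤ B := fun x hx y hy =>
    hB' x (Set.Ioo_subset_Icc_self hx) y (Set.Ioo_subset_Icc_self hy)
  obtain ⟨M, hM, hdiff, hmix, hlip⟩ := hsmooth.exists_lipschitz hC
  -- the linear part
  obtain ⟨y, w, my, mw, ⟨By, hBy⟩, ⟨Bw, hBw⟩, hyw, hyeq, ε, hε, hw⟩ :=
    exists_dominated_extension (g := fun x => rho1 ρ F x - theta ρ F) (B := B + B) hC hM
      (rho1_add_linear_monotoneOn (hmono 0 ⟨by linarith, hC.le⟩) hlip (theta ρ F))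
      fun x hx => (abs_sub _ _).trans (add_le_add (abs_rho1_le hF hB hx) (abs_theta_le hρ hF hB))
  have hyae : ∀ n, (fun ω => y (X n ω)) =ᵐ[P] fun ω => rho1 ρ F (X n ω) - theta ρ F := fun n =>
    (hI n).mono fun ω hω => hyeq hω
  have hyL : ∀ n, MemLp (fun ω => y (X n ω)) 2 P := fun n =>
    memLp_of_bound (my.comp (hX n)) (fun _ => hBy _) 2
  have hrint : ∀ n, Integrable (fun ω => rho1 ρ F (X n ω)) P := fun n => by
    have h1 : Integrable (rho1 ρ F) (P.map (X n)) := by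
      rw [hstat.map_eq n]
      exact integrable_rho1 hρ hF hB
    exact h1.comp_measurable (hX n)
  have hy0 : ∀ n, ∫ ω, y (X n ω) ∂P = 0 := fun n => by
    rw [integral_congr_ae (hyae n), integral_sub (hrint n) (integrable_const _)]
    have h1 : ∫ ω, rho1 ρ F (X n ω) ∂P = theta ρ F := by
      rw [← integral_rho1 hρ hF hB, ← integral_map (f := rho1 ρ F) (hX n).aemeasurable
        (measurable_rho1 hρ).aestronglyMeasurable, hstat.map_eq n]
    rw [h1]
    simp
  have hycov : ∀ i j, cov[fun ω => y (X i ω), fun ω => y (X j ω); P] =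
      cov[fun ω => rho1 ρ F (X i ω), fun ω => rho1 ρ F (X j ω); P] := fun i j => by
    rw [covariance_congr (hyae i) (hyae j), covariance_sub_const_left (hrint i),
      covariance_sub_const_right (hrint j)]
  have hyvar : Var[fun ω => y (X 0 ω); P] = Var[fun ω => rho1 ρ F (X 0 ω); P] := by
    have h1 := hycov 0 0
    rwa [covariance_self (my.fun_comp (hX 0)).aemeasurable,
      covariance_self ((measurable_rho1 hρ).fun_comp (hX 0)).aemeasurable] at h1
  have hVy := hstat.tendsto_variance_sum_div my hyL (by simpa only [hycov] using hsum)
  simp only [hycov, hyvar] at hVy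
  change Tendsto _ _ (nhds (sigmaUSq ρ X P)) at hVy
  set σ := sigmaUSq ρ X P with hσdef
  have hXL : ∀ n, MemLp (fun ω => X n ω) 2 P := fun n =>
    MemLp.of_bound (hX n).aestronglyMeasurable C ((hbdd n).mono fun ω hω => hω.le)
  have hVX := hstat.tendsto_variance_sum_div measurable_id hXL
    ((summable_nat_add_iff 1).2 (summable_of_summable_rpow
      (fun j => hassoc.cov_nonneg_of_bounded hX hC hbdd 0 j) hcov))
  obtain ⟨Ky, hKy⟩ := exists_le_mul_of_tendsto_div (by simpa using variance_fun_zero) hVy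
  obtain ⟨KX, hKX⟩ := exists_le_mul_of_tendsto_div (by simpa using variance_fun_zero) hVX
  -- Almost surely `w = ε y + 2 M x` at the observations, so the variance of the `w`-sums inherits
  -- linear growth from those of `y(X_i)` and `X_i`.
  have hVw : ∀ n : ℕ, Var[fun ω => ∑ i ∈ Finset.range n, w (X i ω); P] ≤
      (2 * Ky + 2 * (2 * M) ^ 2 * KX) * n := fun n => by
    have e : (fun ω => ∑ i ∈ Finset.range n, w (X i ω)) =ᵐ[P] fun ω =>
        ε * ∑ i ∈ Finset.range n, y (X i ω) + 2 * M * ∑ i ∈ Finset.range n, X i ω := by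
      filter_upwards [ae_all_iff.2 hI] with ω hω
      rw [Finset.mul_sum, Finset.mul_sum, ← Finset.sum_add_distrib]
      exact Finset.sum_congr rfl fun i _ => hw _ (hω i)
    rw [variance_congr e]
    refine (variance_const_mul_add_le (memLp_finsetSum _ fun i _ => hyL i)
      (memLp_finsetSum _ fun i _ => hXL i) hε _).trans ?_
    have h1 := hKy n
    have h2 := mul_le_mul_of_nonneg_left (hKX n) (by positivity : 0 ≤ 2 * (2 * M) ^ 2)
    simp only [id] at h2
    linarith
  have hclt := hassoc.tendsto_charFun_sum hstat hX my mw hBy hBw hyw hy0 hVy hVw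
  -- the degenerate part
  obtain ⟨K, hK⟩ := hassoc.integral_abs_sum_sum_le hstat hX hC hbdd hcov hM
    fun x hx n => abs_sum_sum_le (F := F) (measurable_hoeffding2 hρ) (hoeffding2_symm hsymm) hdiff
      hmix (fun x hx => (integral_hoeffding2 hρ hF hB hx).1)
      (fun x hx => (integral_hoeffding2 hρ hF hB hx).2) hF hx hM n
  have hDm : ∀ i j, Measurable fun ω => hoeffding2 ρ F (X i ω) (X j ω) := fun i j =>
    (measurable_hoeffding2 hρ).comp ((hX i).prodMk (hX j))
  have hDi : ∀ i j, Integrable (fun ω => hoeffding2 ρ F (X i ω) (X j ω)) P := fun i j => by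
    refine Integrable.of_bound (hDm i j).aestronglyMeasurable (4 * B) ?_
    filter_upwards [hI i, hI j] with ω hi hj using abs_hoeffding2_le hρ hF hB hi hj
  set R : ℕ → Ω → ℝ := fun n ω => ∑ j ∈ Finset.range n, ∑ i ∈ Finset.range j,
    hoeffding2 ρ F (X i ω) (X j ω) with hR
  have hRi : ∀ n, Integrable (R n) P := fun n =>
    integrable_finsetSum _ fun j _ => integrable_finsetSum _ fun i _ => hDi i j
  -- The full double sum is twice `R` plus a diagonal of size at most `4 B n`, so the diagonal does
  -- not affect the order.
  have hRle : ∀ n : ℕ, ∫ ω, |R n ω| ∂P ≤ (K + 4 * B) / 2 * n := fun n => by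
    have hpt : ∀ᵐ ω ∂P, |R n ω| ≤ 2⁻¹ * (|∑ i ∈ Finset.range n, ∑ j ∈ Finset.range n,
        hoeffding2 ρ F (X i ω) (X j ω)| + 4 * B * n) := by
      filter_upwards [ae_all_iff.2 hI] with ω hω
      have h1 := sum_sum_range_eq (D := fun i j => hoeffding2 ρ F (X i ω) (X j ω))
        (fun i j => hoeffding2_symm hsymm _ _) n
      have h2 : |∑ i ∈ Finset.range n, hoeffding2 ρ F (X i ω) (X i ω)| ≤ 4 * B * n := by
        refine (Finset.abs_sum_le_sum_abs _ _).trans ((Finset.sum_le_card_nsmul _ _ (4 * B)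
          fun i _ => abs_hoeffding2_le hρ hF hB (hω i) (hω i)).trans_eq ?_)
        rw [nsmul_eq_mul, Finset.card_range, mul_comm]
      have h3 : R n ω = 2⁻¹ * (∑ i ∈ Finset.range n, ∑ j ∈ Finset.range n,
          hoeffding2 ρ F (X i ω) (X j ω) -
            ∑ i ∈ Finset.range n, hoeffding2 ρ F (X i ω) (X i ω)) := by
        rw [h1]; ring
      rw [h3, abs_mul, abs_of_pos (by norm_num : (0 : ℝ) < 2⁻¹)]
      have h4 := abs_sub (∑ i ∈ Finset.range n, ∑ j ∈ Finset.range n,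
          hoeffding2 ρ F (X i ω) (X j ω)) (∑ i ∈ Finset.range n, hoeffding2 ρ F (X i ω) (X i ω))
      gcongr
      linarith
    have hi : Integrable (fun ω => |∑ i ∈ Finset.range n, ∑ j ∈ Finset.range n,
        hoeffding2 ρ F (X i ω) (X j ω)|) P :=
      (integrable_finsetSum _ fun i _ => integrable_finsetSum _ fun j _ => hDi i j).abs
    have hmonoR := integral_mono_ae (hRi n).abs ((hi.add (integrable_const (4 * B * n))).const_mul
      (2⁻¹ : ℝ)) hpt
    simp only [Pi.add_apply] at hmonoR
    rw [integral_const_mul, integral_add hi (integrable_const _)] at hmonoR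
    simp only [integral_const, probReal_univ, one_smul] at hmonoR
    linarith [hK n]
  -- conclusion by Lévy's theorem
  have hsσ : 0 < √σ := Real.sqrt_pos.2 hσ
  set Z : ℕ → Ω → ℝ := fun n ω => √(n : ℝ) * (uStat ρ X n ω - theta ρ F) / (2 * √σ) with hZ
  have hZm : ∀ n, Measurable (Z n) := fun n => by
    have hu : Measurable (uStat ρ X n) :=
      (Finset.measurable_sum _ fun j _ => Finset.measurable_sum _ fun i _ =>
        hρ.comp ((hX i).prodMk (hX j))).const_mul _
    exact ((hu.sub_const _).const_mul _).div_const _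
  set T : ℕ → Ω → ℝ := fun n ω =>
    (√(n : ℝ) * √σ)⁻¹ * ∑ i ∈ Finset.range n, y (X i ω) with hT
  have hSm : ∀ n, Measurable fun ω => ∑ i ∈ Finset.range n, y (X i ω) := fun n =>
    Finset.measurable_sum _ fun i _ => my.comp (hX i)
  have hTlim : ∀ t : ℝ, Tendsto (fun n => charFun (P.map (T n)) t) atTop
      (nhds (Complex.exp (-t ^ 2 / 2))) := fun t => by
    have h1 := hclt (t / √σ)
    have e1 : Complex.exp (-(σ : ℂ) * ((t / √σ : ℝ) : ℂ) ^ 2 / 2) =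
        Complex.exp (-(t : ℂ) ^ 2 / 2) := by
      congr 1
      rw [← Complex.ofReal_pow, div_pow, Real.sq_sqrt hσ.le]
      have : (σ : ℂ) ≠ 0 := by exact_mod_cast hσ.ne'
      push_cast
      field_simp
    rw [e1] at h1
    refine h1.congr fun n => ?_
    simp only [hT]
    rw [charFun_map_mul_comp (hSm n).aemeasurable]
    congr 1
    rw [div_div, mul_comm (√σ), div_eq_inv_mul]
  -- The factor 2 of the linear part cancels against the one in `2 √σ`, leaving only the degenerate
  -- remainder.
  have hZT : ∀ n : ℕ, 2 ≤ n → (fun ω => Z n ω - T n ω) =ᵐ[P]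
      fun ω => (√(n : ℝ) / √σ * (n * (n - 1) : ℝ)⁻¹) * R n ω := fun n hn => by
    filter_upwards [ae_all_iff.2 hyae] with ω hω
    simp only [hZ, hT, hR, uStat_sub_theta_eq ρ F hn ω, hω]
    have hn' : (2 : ℝ) ≤ n := by exact_mod_cast hn
    have h1 : (n : ℝ) - 1 ≠ 0 := by linarith
    have h0 : (n : ℝ) ≠ 0 := by linarith
    have h2 : √(n : ℝ) ≠ 0 := (Real.sqrt_pos.2 (by linarith)).ne'
    have h3 : √(n : ℝ) ^ 2 = n := Real.sq_sqrt (by linarith)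
    generalize ∑ i ∈ Finset.range n, (rho1 ρ F (X i ω) - theta ρ F) = S
    field_simp
    rw [h3]
    ring
  refine ⟨fun n => (hZm n).aemeasurable, measurable_id.aemeasurable, ?_⟩
  refine ProbabilityMeasure.tendsto_iff_tendsto_charFun.2 fun t => ?_
  simp only [ProbabilityMeasure.coe_mk, Measure.map_id]
  rw [charFun_gaussianReal]
  have hgoal : Tendsto (fun n => charFun (P.map (Z n)) t) atTop
      (nhds (Complex.exp (-t ^ 2 / 2))) := by
    refine tendsto_of_tendsto_of_dist (hTlim t) ?_
    -- The coefficient `√n / (n (n - 1))` times the bound of order `n` leaves `√n / (n - 1)`, which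
    -- is at most `2 / √n` for `n ≥ 2`.
    have hrate : Tendsto (fun n : ℕ => |t| * ((√σ)⁻¹ * ((K + 4 * B) / 2)) *
        (√(n : ℝ) / (n - 1))) atTop (nhds 0) := by
      have hs : Tendsto (fun n : ℕ => 2 * (√(n : ℝ))⁻¹) atTop (nhds 0) := by
        simpa using ((Real.tendsto_sqrt_atTop.comp
          tendsto_natCast_atTop_atTop).inv_tendsto_atTop).const_mul (2 : ℝ)
      have : Tendsto (fun n : ℕ => √(n : ℝ) / (n - 1)) atTop (nhds 0) := by
        refine squeeze_zero' ?_ ?_ hs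
        · filter_upwards [eventually_ge_atTop 2] with n hn
          have hn' : (2 : ℝ) ≤ n := by exact_mod_cast hn
          exact div_nonneg (Real.sqrt_nonneg _) (by linarith)
        · filter_upwards [eventually_ge_atTop 2] with n hn
          have hn' : (2 : ℝ) ≤ n := by exact_mod_cast hn
          have h2 : 0 < √(n : ℝ) := Real.sqrt_pos.2 (by linarith)
          rw [div_le_iff₀ (by linarith), mul_comm 2, mul_assoc, inv_mul_eq_div, le_div_iff₀ h2,
            Real.mul_self_sqrt (by linarith)]
          linarith
      simpa using this.const_mul (|t| * ((√σ)⁻¹ * ((K + 4 * B) / 2)))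
    refine squeeze_zero' (Eventually.of_forall fun _ => dist_nonneg) ?_ hrate
    filter_upwards [eventually_ge_atTop 2] with n hn
    have hn' : (2 : ℝ) ≤ n := by exact_mod_cast hn
    have hcoef : 0 ≤ √(n : ℝ) / √σ * (n * (n - 1) : ℝ)⁻¹ := by
      have : 0 ≤ (n : ℝ) - 1 := by linarith
      positivity
    rw [dist_comm, dist_eq_norm]
    refine (norm_charFun_sub_le (hZm n) ((hSm n).const_mul _)
      (((hRi n).const_mul _).congr (hZT n hn).symm) t).trans ?_
    have h1 : ∫ ω, |Z n ω - T n ω| ∂P =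
        (√(n : ℝ) / √σ * (n * (n - 1) : ℝ)⁻¹) * ∫ ω, |R n ω| ∂P := by
      rw [← integral_const_mul]
      refine integral_congr_ae ((hZT n hn).mono fun ω hω => ?_)
      simp only at hω ⊢
      rw [hω, abs_mul, abs_of_nonneg hcoef]
    rw [h1, mul_assoc |t|]
    refine mul_le_mul_of_nonneg_left ?_ (abs_nonneg t)
    refine (mul_le_mul_of_nonneg_left (hRle n) hcoef).trans (le_of_eq ?_)
    have h2 : (n : ℝ) - 1 ≠ 0 := by linarith
    have h0 : (n : ℝ) ≠ 0 := by linarith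
    field_simp
  convert hgoal using 2
  simp [neg_div]
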